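/- Let $G=(V,E)$ be a finite tree with $n=|V|$ vertices and maximum degree $\Delta$, let $q$ be a non-negative integer, let $L$ assign to each $v\in V$ a list $L(v)\subseteq\{1,\dots,q\}$, and let $\epsilon>0$. Suppose that $(G,L)$ is an $\epsilon\Delta$-extra-color instance, i.e. $|L(v)|\ge \epsilon\Delta+\deg_G(v)$ for every $v\in V$, and that $\frac{\ln^2\Delta}{\Delta}\le\frac{\epsilon^2}{100}$. Let $X$ be the pure $(n-1)$-dimensional simplicial complex on the ground set $V\times\{1,\dots,q\}$ whose facets are the sets $\{(v,\sigma(v)):v\in V\}$, where $\sigma$ ranges over the proper $L$-list-colorings of $G$ (that is, $\sigma(v)\in L(v)$ for all $v$, and $\sigma(u)\ne\sigma(v)$ whenever $u,v$ are adjacent); its faces are all subsets of facets, including $\emptyset$. Let $\pi_{n-1}$ be the uniform distribution on the facets. The co-dimension of a face $\tau$ is $n-|\tau|$, and its link is $X_\tau=\{\sigma\setminus\tau:\sigma\in X,\ \sigma\supseteq\tau\}$; write $X_\tau(0)$ for the set of vertices (elements $x$ with $\{x\}\in X_\tau$) of the link, and $X(0)=X_\emptyset(0)$. For a face $\tau$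 of co-dimension $k\ge 2$ let $P_\tau\in\mathbb{R}^{X(0)\times X(0)}$ be the matrix of the local walk for $\tau$: for distinct $x,y\in X_\tau(0)$, $$P_\tau(x,y)=\frac{1}{k-1}\Pr_{\sigma\sim\pi_{n-1}}\bigl[y\in\sigma \,\big|\, \sigma\supseteq\tau\cup\{x\}\bigr],$$ and all other entries of $P_\tau$ (the diagonal, and the entries outside the block $X_\tau(0)\times X_\tau(0)$) are zero. All eigenvalues of $P_\tau$ are real; let $\lambda_2(P_\tau)$ be the second largest one, counted with multiplicity. Then for every $2\le k\le n$ and every face $\tau\in X$ of co-dimension $k$, $$\lambda_2(P_\tau)\le\frac{\frac1{20}+\frac1\epsilon}{k-1}.$$ -/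

import Mathlib

/-!  Weighted simplicial complexes.  A pure `d`-dimensional simplicial complex on a finite ground
set `U` is given by the finite set `F` of its facets (sets with `d + 1` elements); its faces are
all subsets of facets, the empty one included.  A distribution on the facets is given by its
weights `w`. -/

/-- `τ` is a face of the complex with facets `F`. -/
def IsFace {U : Type*} (F : Finset (Finset U)) (τ : Finset U) : Prop :=
  ∃ σ ∈ F, τ ⊆ σ

/-- The co-dimension `d - dim τ` of a face in a `d`-dimensional complex, `dim τ = |τ| - 1`. -/
def codim {U : Type*} (d : ℤ) (τ : Finset U) : ℤ := d - ((τ.card : ℤ) - 1)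

/-- The link `X_τ = {σ \ τ : σ ∈ X, σ ⊇ τ}`. -/
def link {U : Type*} [DecidableEq U] (F : Finset (Finset U)) (τ : Finset U) : Set (Finset U) :=
  {η | ∃ σ, IsFace F σ ∧ τ ⊆ σ ∧ η = σ \ τ}

open Classical in
/-- The vertices `X_τ(0)` of the link of `τ`. -/
noncomputable def linkVertices {U : Type*} [Fintype U] [DecidableEq U] (F : Finset (Finset U))
    (τ : Finset U) : Finset U :=
  Finset.univ.filter fun x => {x} ∈ link F τ

/-- `Pr_{σ ∼ w} [σ ⊇ η | σ ⊇ τ]`, for a random facet `σ` with distribution `w`. -/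
noncomputable def containProb {U : Type*} [DecidableEq U] (F : Finset (Finset U))
    (w : Finset U → ℝ) (η τ : Finset U) : ℝ :=
  (∑ σ ∈ F with τ ⊆ σ ∧ η ⊆ σ, w σ) / (∑ σ ∈ F with τ ⊆ σ, w σ)

/-- The matrix `P_τ`, indexed by `X(0)`: on the block `X_τ(0) × X_τ(0)` it is the transition matrix
of the local walk for `τ`, that is, for `k` the co-dimension of `τ`,
`P_τ (x, y) = (1 / (k - 1)) * Pr [y ∈ σ | σ ⊇ τ ∪ {x}]` for `x ≠ y`, and `P_τ (x, x) = 0`;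
all entries outside that block are zero. -/
noncomputable def localWalk {U : Type*} [Fintype U] [DecidableEq U] (F : Finset (Finset U))
    (w : Finset U → ℝ) (d : ℤ) (τ : Finset U) :
    Matrix (linkVertices F ∅) (linkVertices F ∅) ℝ :=
  Matrix.of fun x y =>
    if x ≠ y ∧ (x : U) ∈ linkVertices F τ ∧ (y : U) ∈ linkVertices F τ then
      1 / ((codim d τ : ℝ) - 1) * containProb F w {(y : U)} (insert (x : U) τ)
    else 0

/-- The second largest eigenvalue, counted with multiplicity, of a square matrix of size at least 2
all of whose eigenvalues are real. -/
noncomputable def secondEigenvalue {n : Type*} [Fintype n] [DecidableEq n]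
    (A : Matrix n n ℝ) : ℝ :=
  (A.charpoly.roots.sort (· ≥ ·)).getD 1 0

/-- A matrix in detailed balance with a positive vector has only real eigenvalues. -/
theorem splits_charpoly_of_reversible {n : Type*} [Fintype n] [DecidableEq n]
    (A : Matrix n n ℝ) (p : n → ℝ) (hp : ∀ x, 0 < p x)
    (h : ∀ x y, p x * A x y = p y * A y x) : A.charpoly.Splits := by
  classical
  have hs : ∀ x, Real.sqrt (p x) ≠ 0 := fun x => (Real.sqrt_pos.2 (hp x)).ne'
  let S : (Matrix n n ℝ)ˣ :=
    ⟨Matrix.diagonal fun x => Real.sqrt (p x), Matrix.diagonal fun x => (Real.sqrt (p x))⁻¹,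
      by simp [Matrix.diagonal_mul_diagonal, hs], by simp [Matrix.diagonal_mul_diagonal, hs]⟩
  have hB : (S.val * A * S⁻¹.val).IsHermitian := by
    ext x y
    have e : ∀ x y, (S.val * A * S⁻¹.val) x y
        = Real.sqrt (p x) * A x y * (Real.sqrt (p y))⁻¹ := by
      intro x y
      change (Matrix.diagonal (fun x => Real.sqrt (p x)) * A *
        Matrix.diagonal fun x => (Real.sqrt (p x))⁻¹) x y = _
      rw [Matrix.mul_diagonal, Matrix.diagonal_mul]
    rw [Matrix.conjTranspose_apply, e, e, star_trivial]
    have h1 := h x y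
    have hx := Real.mul_self_sqrt (hp x).le
    have hy := Real.mul_self_sqrt (hp y).le
    have hx0 := hs x
    have hy0 := hs y
    field_simp
    rw [pow_two, pow_two, hx, hy]
    linarith
  have := hB.splits_charpoly
  have hc : (S.val * A * S⁻¹.val).charpoly = A.charpoly := by
    rw [Matrix.coe_units_inv, Matrix.charpoly_units_conj]
  rwa [hc] at this

theorem mem_linkVertices {U : Type*} [Fintype U] [DecidableEq U] (F : Finset (Finset U))
    (τ : Finset U) (x : U) : x ∈ linkVertices F τ ↔ x ∉ τ ∧ IsFace F (insert x τ) := by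
  have h : x ∈ linkVertices F τ ↔ ∃ σ, IsFace F σ ∧ τ ⊆ σ ∧ {x} = σ \ τ := by
    classical
    rw [linkVertices, Finset.mem_filter]
    exact ⟨fun h => h.2, fun h => ⟨Finset.mem_univ x, h⟩⟩
  rw [h]
  constructor
  · rintro ⟨σ, ⟨ρ, hρ, hσρ⟩, hτσ, hx⟩
    have hx' : x ∈ σ \ τ := hx ▸ Finset.mem_singleton_self x
    rw [Finset.mem_sdiff] at hx'
    exact ⟨hx'.2, ρ, hρ, Finset.insert_subset (hσρ hx'.1) (hτσ.trans hσρ)⟩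
  · rintro ⟨hx, hf⟩
    refine ⟨insert x τ, hf, Finset.subset_insert x τ, ?_⟩
    ext y
    simp only [Finset.mem_singleton, Finset.mem_sdiff, Finset.mem_insert]
    constructor
    · rintro rfl
      exact ⟨Or.inl rfl, hx⟩
    · rintro ⟨h | h, h'⟩
      · exact h
      · exact absurd h h'

/-- All eigenvalues of `P_τ` are real, so `secondEigenvalue` applies to it. -/
theorem splits_charpoly_localWalk {U : Type*} [Fintype U] [DecidableEq U]
    (F : Finset (Finset U)) (w : Finset U → ℝ) (hw : ∀ σ ∈ F, 0 < w σ) (d : ℤ) (τ : Finset U) :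
    (localWalk F w d τ).charpoly.Splits := by
  classical
  have hpos : ∀ x ∈ linkVertices F τ, 0 < ∑ σ ∈ F with insert x τ ⊆ σ, w σ := by
    intro x hx
    obtain ⟨-, σ, hσ, hs⟩ := (mem_linkVertices F τ x).1 hx
    exact Finset.sum_pos (fun ρ hρ => hw ρ (Finset.mem_filter.1 hρ).1)
      ⟨σ, Finset.mem_filter.2 ⟨hσ, hs⟩⟩
  refine splits_charpoly_of_reversible _
    (fun x => if (x : U) ∈ linkVertices F τ then ∑ σ ∈ F with insert (x : U) τ ⊆ σ, w σ else 1)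
    (fun x => ?_) (fun x y => ?_)
  · split_ifs with hx
    · exact hpos _ hx
    · exact one_pos
  · by_cases hx : (x : U) ∈ linkVertices F τ
    · by_cases hy : (y : U) ∈ linkVertices F τ
      · by_cases hxy : x = y
        · rw [hxy]
        · have h1 := (hpos _ hx).ne'
          have h2 := (hpos _ hy).ne'
          have e : (∑ σ ∈ F with insert (x : U) τ ⊆ σ ∧ {(y : U)} ⊆ σ, w σ)
              = ∑ σ ∈ F with insert (y : U) τ ⊆ σ ∧ {(x : U)} ⊆ σ, w σ := by
            congr 1
            ext σ
            simp only [Finset.mem_filter, Finset.insert_subset_iff, Finset.singleton_subset_iff]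
            tauto
          simp only [localWalk, Matrix.of_apply, hx, hy, hxy, Ne.symm hxy, ne_eq,
            not_false_eq_true, and_self, if_true, containProb, e]
          field_simp
      · simp [localWalk, hx, hy]
    · simp [localWalk, hx]

/-!  Vertex-list-colorings. -/

/-- `σ` is a proper `L`-vertex-list-coloring of `G`. -/
def IsProperListColoring {V : Type*} (G : SimpleGraph V) {q : ℕ} (L : V → Finset (Fin q))
    (σ : V → Fin q) : Prop :=
  (∀ v, σ v ∈ L v) ∧ ∀ u v, G.Adj u v → σ u ≠ σ v

open Classical in
/-- The facets `{(v, σ v) : v ∈ V}`, `σ` a proper `L`-vertex-list-coloring of `G`, of the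
`(|V| - 1)`-dimensional complex `X(G, L)`. -/
noncomputable def coloringFacets {V : Type*} [Fintype V] [DecidableEq V] (G : SimpleGraph V)
    {q : ℕ} (L : V → Finset (Fin q)) : Finset (Finset (V × Fin q)) :=
  (Finset.univ.filter fun σ : V → Fin q => IsProperListColoring G L σ).image
    fun σ => Finset.univ.image fun v => (v, σ v)

/-- The weights of the uniform distribution on the finite set `F`. -/
noncomputable def uniformWeight {α : Type*} [DecidableEq α] (F : Finset α) (a : α) : ℝ :=
  if a ∈ F then 1 / (F.card : ℝ) else 0

/-- `(G, L)` is a `β`-extra-color vertex-list-coloring instance. -/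
def IsExtraColor {V : Type*} [Fintype V] (G : SimpleGraph V) [DecidableRel G.Adj] {q : ℕ}
    (L : V → Finset (Fin q)) (β : ℝ) : Prop :=
  ∀ v, β + (G.degree v : ℝ) ≤ ((L v).card : ℝ)

/-- The matrix `P_τ` of the complex `X(G, L)` with the uniform distribution on its facets. -/
noncomputable def coloringLocalWalk {V : Type*} [Fintype V] [DecidableEq V] (G : SimpleGraph V)
    {q : ℕ} (L : V → Finset (Fin q)) (τ : Finset (V × Fin q)) :
    Matrix (linkVertices (coloringFacets G L) ∅) (linkVertices (coloringFacets G L) ∅) ℝ :=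
  localWalk (coloringFacets G L) (uniformWeight (coloringFacets G L))
    ((Fintype.card V : ℤ) - 1) τ

/-!
After the colors in `τ` are prescribed, the facets that contain `τ` are the colorings of the whole
tree from lists in which a prescribed vertex keeps one color; let `Ω` be the set of these colorings.
In the stationary inner product, the matrix `(k - 1) P_τ` is the form
`f ↦ E (∑ v, f v (σ v)) ^ 2 - ∑ v, E (f v (σ v)) ^ 2`, `σ` uniform on `Ω`, on the functions that
live on the link. By Courant–Fischer it therefore suffices to bound this form on the hyperplane
where `∑ v, f v (σ v)` has mean zero, that is, to prove
`Var (∑ v, f v (σ v)) ≤ (1 + 1 / 20 + 1 / ε) ∑ v, E (f v (σ v)) ^ 2`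
(`secondEigenvalue_coloringLocalWalk_le`).

This is a statement about a Markov field on a tree, and follows from a bound on the correlation
along single edges. Without the edge `uv` the colors of `u` and `v` would be independent
(`card_mul_sum_mul_eq`), and recoloring an end whose color is not prescribed shows that each color
has odds at most `1 / β` there, where `β = ε Δ` (`mul_card_color_eq_le`); centered functions of a
prescribed color vanish. Conditioning on `σ u ≠ σ v` changes the product measure
by a diagonal term only, so that the maximal correlation of `σ u` and `σ v` is at most `1 / β`
(`sq_mul_sum_condMean_sq_le`, `exists_condMean`).

Root the tree, and remove the deepest vertices one by one, each time replacing the function at the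
removed vertex by its conditional mean at the parent. With `ρ = 1 / β` this gives a variance bound
with constant `1 + ρ = 1 + 1 / ε` if `Δ = 1`, and about `1 + 2 ρ √(Δ - 1)` if `Δ ≥ 2`
(`norm_sum_sq_le_of_rootedTree`). As `2 √(Δ - 1) ≤ Δ`, the term `2 ρ √(Δ - 1)` is at most `1 / ε`,
and the assumption on `ln² Δ / Δ` leaves at most `1 / 20` for the terms of higher order
(`exists_recursion_parameter`).
-/

/-! ### The second eigenvalue of a reversible matrix -/

theorem exists_ne_of_lt_secondEigenvalue {n : Type*} [Fintype n] [DecidableEq n]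
    {A : Matrix n n ℝ} {ev : n → ℝ} (hA : A.charpoly.roots = Multiset.map ev Finset.univ.val)
    {μ : ℝ} (hμ : 0 ≤ μ) (h : μ < secondEigenvalue A) : ∃ i j, i ≠ j ∧ μ < ev i ∧ μ < ev j := by
  have hs : 2 ≤ (A.charpoly.roots.filter (μ < ·)).card := by
    have hsort := Multiset.pairwise_sort A.charpoly.roots (· ≥ ·)
    have hcoe := Multiset.sort_eq A.charpoly.roots (· ≥ ·)
    unfold secondEigenvalue at h
    generalize A.charpoly.roots.sort (· ≥ ·) = l at h hsort hcoe
    rw [← hcoe]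
    match l with
    | [] => simp at h; linarith
    | [a] => simp at h; linarith
    | a :: b :: t =>
      have hb : μ < b := by simpa using h
      have hab : b ≤ a := by
        rw [List.pairwise_cons] at hsort
        exact hsort.1 b (by simp)
      have ha : μ < a := hb.trans_le hab
      simp [ha, hb]
  rw [hA, Multiset.filter_map, Multiset.card_map] at hs
  have hc : 1 < (Finset.univ.filter fun i => μ < ev i).card := by
    rw [Finset.card_def, Finset.filter_val]
    exact hs
  obtain ⟨i, hi, j, hj, hij⟩ := Finset.one_lt_card.1 hc
  exact ⟨i, j, hij, (Finset.mem_filter.1 hi).2, (Finset.mem_filter.1 hj).2⟩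

/-- One direction of the Courant–Fischer principle for a reversible matrix: the second eigenvalue
is at most any `μ ≥ 0` that bounds the Rayleigh quotient on some hyperplane. -/
theorem secondEigenvalue_le_of_reversible {n : Type*} [Fintype n] [DecidableEq n]
    (A : Matrix n n ℝ) (p : n → ℝ) (hp : ∀ x, 0 < p x)
    (h : ∀ x y, p x * A x y = p y * A y x) (c : n → ℝ) {μ : ℝ} (hμ : 0 ≤ μ)
    (hA : ∀ f : n → ℝ, ∑ x, c x * f x = 0 →
      ∑ x, ∑ y, p x * A x y * f x * f y ≤ μ * ∑ x, p x * f x ^ 2) :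
    secondEigenvalue A ≤ μ := by
  have hs : ∀ x, Real.sqrt (p x) ≠ 0 := fun x => (Real.sqrt_pos.2 (hp x)).ne'
  let S : (Matrix n n ℝ)ˣ :=
    ⟨Matrix.diagonal fun x => Real.sqrt (p x), Matrix.diagonal fun x => (Real.sqrt (p x))⁻¹,
      by simp [Matrix.diagonal_mul_diagonal, hs], by simp [Matrix.diagonal_mul_diagonal, hs]⟩
  obtain ⟨B, hBdef⟩ : ∃ B, B = S.val * A * S⁻¹.val := ⟨_, rfl⟩
  have e : ∀ x y, B x y = Real.sqrt (p x) * A x y * (Real.sqrt (p y))⁻¹ := by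
    intro x y
    rw [hBdef]
    change (Matrix.diagonal (fun x => Real.sqrt (p x)) * A *
      Matrix.diagonal fun x => (Real.sqrt (p x))⁻¹) x y = _
    rw [Matrix.mul_diagonal, Matrix.diagonal_mul]
  have hpA : ∀ x y, p x * A x y = Real.sqrt (p x) * Real.sqrt (p y) * B x y := by
    intro x y
    have hx := Real.mul_self_sqrt (hp x).le
    have hy0 := hs y
    rw [e]
    field_simp
    rw [pow_two, hx, mul_comm]
  have hB : B.IsHermitian := by
    ext x y
    have h1 := h x y
    rw [hpA, hpA, mul_comm (Real.sqrt (p y))] at h1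
    rw [Matrix.conjTranspose_apply, star_trivial]
    exact (mul_left_cancel₀ (mul_ne_zero (hs x) (hs y)) h1).symm
  have hroots : A.charpoly.roots = Multiset.map hB.eigenvalues Finset.univ.val := by
    have hc : B.charpoly = A.charpoly := by
      rw [hBdef, Matrix.coe_units_inv, Matrix.charpoly_units_conj]
    rw [← hc, hB.roots_charpoly_eq_eigenvalues]
    rfl
  by_contra! hlt
  obtain ⟨i, j, hij, hi, hj⟩ := exists_ne_of_lt_secondEigenvalue hroots hμ hlt
  have hon : ∀ i j, ∑ x, hB.eigenvectorBasis i x * hB.eigenvectorBasis j x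
      = if i = j then (1 : ℝ) else 0 := by
    intro i j
    rw [← (orthonormal_iff_ite.1 hB.eigenvectorBasis.orthonormal) i j]
    simp [PiLp.inner_apply, mul_comm]
  have hev : ∀ i x, ∑ y, B x y * hB.eigenvectorBasis i y
      = hB.eigenvalues i * hB.eigenvectorBasis i x := by
    intro i x
    have := congrFun (hB.mulVec_eigenvectorBasis i) x
    simpa [Matrix.mulVec, dotProduct] using this
  have hii := hon i i
  have hjj := hon j j
  have hij' := hon i j
  have hevi := hev i
  have hevj := hev j
  rw [if_pos rfl] at hii hjj
  rw [if_neg hij] at hij'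
  obtain ⟨u, hu⟩ : ∃ u : n → ℝ, ∀ x, hB.eigenvectorBasis i x = u x := ⟨_, fun _ => rfl⟩
  obtain ⟨w, hw⟩ : ∃ w : n → ℝ, ∀ x, hB.eigenvectorBasis j x = w x := ⟨_, fun _ => rfl⟩
  simp only [hu, hw] at hii hjj hij' hevi hevj
  -- a nonzero combination of the two eigenvectors lies in the hyperplane
  obtain ⟨α, β, hαβ, hlin⟩ : ∃ α β : ℝ, 0 < α ^ 2 + β ^ 2 ∧
      α * ∑ x, c x * (u x / Real.sqrt (p x)) + β * ∑ x, c x * (w x / Real.sqrt (p x)) = 0 := by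
    generalize ∑ x, c x * (u x / Real.sqrt (p x)) = a
    generalize ∑ x, c x * (w x / Real.sqrt (p x)) = b
    by_cases ha : a = 0
    · exact ⟨1, 0, by norm_num, by simp [ha]⟩
    · refine ⟨b, -a, ?_, by ring⟩
      have : 0 < (-a) ^ 2 := by rw [neg_sq]; positivity
      positivity
  have h1 := hA (fun x => (α * u x + β * w x) / Real.sqrt (p x)) (by
    rw [← hlin, Finset.mul_sum, Finset.mul_sum, ← Finset.sum_add_distrib]
    exact Finset.sum_congr rfl fun x _ => by ring)
  have h2 : ∑ x, p x * ((α * u x + β * w x) / Real.sqrt (p x)) ^ 2 = α ^ 2 + β ^ 2 := by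
    have : ∀ x, p x * ((α * u x + β * w x) / Real.sqrt (p x)) ^ 2
        = α ^ 2 * (u x * u x) + 2 * α * β * (u x * w x) + β ^ 2 * (w x * w x) := by
      intro x
      have := (hp x).ne'
      rw [div_pow, Real.sq_sqrt (hp x).le]
      field_simp
      ring
    simp only [this, Finset.sum_add_distrib, ← Finset.mul_sum, hii, hjj, hij']
    ring
  have h3 : ∑ x, ∑ y, p x * A x y * ((α * u x + β * w x) / Real.sqrt (p x))
      * ((α * u y + β * w y) / Real.sqrt (p y))
      = α ^ 2 * hB.eigenvalues i + β ^ 2 * hB.eigenvalues j := by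
    have : ∀ x, ∑ y, p x * A x y * ((α * u x + β * w x) / Real.sqrt (p x))
        * ((α * u y + β * w y) / Real.sqrt (p y))
        = α ^ 2 * hB.eigenvalues i * (u x * u x)
          + α * β * (hB.eigenvalues i + hB.eigenvalues j) * (u x * w x)
          + β ^ 2 * hB.eigenvalues j * (w x * w x) := by
      intro x
      have : ∀ y, p x * A x y * ((α * u x + β * w x) / Real.sqrt (p x))
          * ((α * u y + β * w y) / Real.sqrt (p y))
          = (α * u x + β * w x) * (α * (B x y * u y) + β * (B x y * w y)) := by
        intro y
        have hx0 := hs x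
        have hy0 := hs y
        rw [hpA]
        field_simp
      simp only [this, ← Finset.mul_sum, Finset.sum_add_distrib, hevi, hevj]
      ring
    simp only [this, Finset.sum_add_distrib, ← Finset.mul_sum, hii, hjj, hij']
    ring
  rw [h2, h3] at h1
  have hi' := mul_nonneg (sq_nonneg α) (sub_nonneg.2 hi.le)
  have hj' := mul_nonneg (sq_nonneg β) (sub_nonneg.2 hj.le)
  rcases eq_or_ne α 0 with h0 | h0
  · have : 0 < β ^ 2 := by rw [h0] at hαβ; simpa using hαβ
    nlinarith [mul_pos this (sub_pos.2 hj)]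
  · have : 0 < α ^ 2 := by positivity
    nlinarith [mul_pos this (sub_pos.2 hi)]

/-! ### The variance recursion on a rooted tree -/

/-- The variance recursion on a rooted tree, in a Hilbert space. The vertices carry subspaces
`H v`; projecting `f ∈ H v` onto the span of the subspaces of the other vertices that are not
deeper than `v` gives an element of `H (parent v)`, of norm at most `ρ ‖f‖`. The weight of `v` in
the bound is the inverse of a number that starts at `1` (for the root) or at `1 / (1 + C ρ²)` (for
the other vertices) and loses `1 / (C + 1)` for every child; `C` is a free parameter. -/
theorem norm_sum_sq_le_of_rootedTree {E V : Type*} [NormedAddCommGroup E] [InnerProductSpace ℝ E]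
    [DecidableEq V] (H : V → Submodule ℝ E) (r : V) (parent : V → V) (depth : V → ℕ)
    (hr : depth r = 0) (hdepth : ∀ v, v ≠ r → depth (parent v) < depth v) {ρ C : ℝ}
    (hC : 0 ≤ C)
    (hproj : ∀ v, v ≠ r → ∀ f ∈ H v, ∃ h ∈ H (parent v), ‖h‖ ≤ ρ * ‖f‖ ∧
      ∀ w, w ≠ v → depth w ≤ depth v → ∀ g ∈ H w, inner ℝ (f - h) g = 0)
    (S : Finset V) (hS : ∀ v ∈ S, v ≠ r → parent v ∈ S)
    (hpos : ∀ v ∈ S, 0 < (if v = r then 1 else 1 / (1 + C * ρ ^ 2))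
      - ((S.filter fun w => w ≠ r ∧ parent w = v).card : ℝ) / (C + 1))
    (f : V → E) (hf : ∀ v, f v ∈ H v) :
    ‖∑ v ∈ S, f v‖ ^ 2 ≤ ∑ v ∈ S, ‖f v‖ ^ 2 / ((if v = r then 1 else 1 / (1 + C * ρ ^ 2))
      - ((S.filter fun w => w ≠ r ∧ parent w = v).card : ℝ) / (C + 1)) := by
  have hC1 : 0 < C + 1 := by linarith
  induction S using Finset.induction_on_max_value depth generalizing f with
  | empty => simp
  | insert v s hv hmax ih =>
    by_cases hvr : v = r
    · -- the root is the deepest vertex only if it is the only one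
      have hs : s = ∅ := by
        by_contra hne
        obtain ⟨w, hw⟩ := Finset.nonempty_iff_ne_empty.2 hne
        have hwr : w ≠ r := fun h => hv (by rw [hvr, ← h]; exact hw)
        have h1 := hdepth w hwr
        have h2 := hmax w hw
        rw [hvr, hr] at h2
        omega
      subst hs hvr
      simp [Finset.filter_insert]
    · have hclosed : ∀ w ∈ s, w ≠ r → parent w ∈ s := by
        intro w hw hwr
        have h1 := hS w (Finset.mem_insert_of_mem hw) hwr
        have h2 := hdepth w hwr
        have h3 := hmax w hw
        rcases Finset.mem_insert.1 h1 with h | h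
        · rw [h] at h2; omega
        · exact h
      have huv : parent v ≠ v := fun h => by have := hdepth v hvr; rw [h] at this; omega
      have hu : parent v ∈ s := by
        rcases Finset.mem_insert.1 (hS v (Finset.mem_insert_self v s) hvr) with h | h
        · exact absurd h huv
        · exact h
      -- the numbers of children with and without `v`
      have hcard_u : ((insert v s).filter fun w => w ≠ r ∧ parent w = parent v).card
          = (s.filter fun w => w ≠ r ∧ parent w = parent v).card + 1 := by
        rw [Finset.filter_insert, if_pos ⟨hvr, rfl⟩, Finset.card_insert_of_notMem]
        simp [hv]
      have hcard : ∀ x, x ≠ parent v → ((insert v s).filter fun w => w ≠ r ∧ parent w = x)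
          = (s.filter fun w => w ≠ r ∧ parent w = x) := by
        intro x hx
        rw [Finset.filter_insert, if_neg]
        exact fun h => hx h.2.symm
      have hcard_v : (s.filter fun w => w ≠ r ∧ parent w = v) = ∅ := by
        refine Finset.filter_eq_empty_iff.2 ?_
        rintro w hw ⟨hwr, rfl⟩
        have := hdepth w hwr
        have := hmax w hw
        omega
      have hpos' : ∀ w ∈ s, 0 < (if w = r then 1 else 1 / (1 + C * ρ ^ 2))
          - ((s.filter fun x => x ≠ r ∧ parent x = w).card : ℝ) / (C + 1) := by
        intro w hw
        refine (hpos w (Finset.mem_insert_of_mem hw)).trans_le (sub_le_sub_left ?_ _)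
        gcongr
        exact Finset.subset_insert _ _
      obtain ⟨h, hh, hle, horth⟩ := hproj v hvr (f v) (hf v)
      set f' : V → E := Function.update f (parent v) (f (parent v) + h) with hf'def
      have hf' : ∀ w, f' w ∈ H w := by
        intro w
        by_cases hw : w = parent v
        · subst hw
          simpa [hf'def] using (H (parent v)).add_mem (hf _) hh
        · simpa [hf'def, hw] using hf w
      have key := ih hclosed hpos' f' hf'
      have hsum : ∑ w ∈ insert v s, f w = (f v - h) + ∑ w ∈ s, f' w := by
        rw [Finset.sum_insert hv, hf'def, Finset.sum_update_of_mem hu,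
          ← Finset.add_sum_erase s f hu, Finset.sdiff_singleton_eq_erase]
        abel
      have ho1 : inner ℝ (f v - h) (∑ w ∈ s, f' w) = 0 := by
        rw [inner_sum]
        exact Finset.sum_eq_zero fun w hw =>
          horth w (fun e => hv (e ▸ hw)) (hmax w hw) _ (hf' w)
      have ho2 : inner ℝ (f v - h) h = 0 := horth _ huv (hdepth v hvr).le _ hh
      have hn1 : ‖∑ w ∈ insert v s, f w‖ ^ 2 = ‖f v - h‖ ^ 2 + ‖∑ w ∈ s, f' w‖ ^ 2 := by
        rw [hsum, norm_add_sq_real, ho1]; ring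
      have hn2 : ‖f v‖ ^ 2 = ‖f v - h‖ ^ 2 + ‖h‖ ^ 2 := by
        conv_lhs => rw [← sub_add_cancel (f v) h]
        rw [norm_add_sq_real, ho2]; ring
      have hh2 : ‖h‖ ^ 2 ≤ ρ ^ 2 * ‖f v‖ ^ 2 := by
        rw [← mul_pow]; exact pow_le_pow_left₀ (norm_nonneg _) hle 2
      have e1 := Finset.add_sum_erase s (fun w => ‖f' w‖ ^ 2 /
        ((if w = r then 1 else 1 / (1 + C * ρ ^ 2))
          - ((s.filter fun x => x ≠ r ∧ parent x = w).card : ℝ) / (C + 1))) hu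
      have e2 := Finset.add_sum_erase s (fun w => ‖f w‖ ^ 2 /
        ((if w = r then 1 else 1 / (1 + C * ρ ^ 2))
          - (((insert v s).filter fun x => x ≠ r ∧ parent x = w).card : ℝ) / (C + 1))) hu
      beta_reduce at e1 e2
      rw [← e1] at key
      rw [hn1, Finset.sum_insert hv, ← e2, hcard v huv.symm, hcard_v, hcard_u, if_neg hvr]
      have hrest : ∑ w ∈ s.erase (parent v), ‖f' w‖ ^ 2 /
            ((if w = r then 1 else 1 / (1 + C * ρ ^ 2))
            - ((s.filter fun x => x ≠ r ∧ parent x = w).card : ℝ) / (C + 1))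
          = ∑ w ∈ s.erase (parent v), ‖f w‖ ^ 2 / ((if w = r then 1 else 1 / (1 + C * ρ ^ 2))
            - (((insert v s).filter fun x => x ≠ r ∧ parent x = w).card : ℝ) / (C + 1)) := by
        refine Finset.sum_congr rfl fun w hw => ?_
        rw [Finset.mem_erase] at hw
        rw [hcard w hw.1, hf'def, Function.update_of_ne hw.1]
      rw [hrest] at key
      have hposu := hpos (parent v) (Finset.mem_insert_of_mem hu)
      rw [hcard_u] at hposu
      have hfu : f' (parent v) = f (parent v) + h := by simp [hf'def]
      rw [hfu] at key
      -- both the weight of the parent and that of `v` come from Cauchy–Schwarz in Engel form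
      have hcs : ∀ a b A B : ℝ, 0 < A → 0 < B → (a + b) ^ 2 / (A + B) ≤ a ^ 2 / A + b ^ 2 / B := by
        intro a b A B hA hB
        rw [div_add_div _ _ hA.ne' hB.ne', div_le_div_iff₀ (by positivity) (by positivity)]
        nlinarith [mul_nonneg (mul_pos hA hB).le (sq_nonneg (a * B - b * A)),
          sq_nonneg (a * B - b * A)]
      have hn3 : ‖f (parent v) + h‖ ^ 2 ≤ (‖f (parent v)‖ + ‖h‖) ^ 2 :=
        pow_le_pow_left₀ (norm_nonneg _) (norm_add_le _ _) 2
      have hengel : ‖f (parent v) + h‖ ^ 2 / ((if parent v = r then 1 else 1 / (1 + C * ρ ^ 2))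
            - ((s.filter fun w => w ≠ r ∧ parent w = parent v).card : ℝ) / (C + 1))
          ≤ ‖f (parent v)‖ ^ 2 / ((if parent v = r then 1 else 1 / (1 + C * ρ ^ 2))
            - (((s.filter fun w => w ≠ r ∧ parent w = parent v).card + 1 : ℕ) : ℝ) / (C + 1))
            + (C + 1) * ‖h‖ ^ 2 := by
        refine (div_le_div_of_nonneg_right hn3 (hpos' _ hu).le).trans ?_
        have := hcs ‖f (parent v)‖ ‖h‖ _ (1 / (C + 1)) hposu (by positivity)
        have e1 : ‖h‖ ^ 2 / (1 / (C + 1)) = (C + 1) * ‖h‖ ^ 2 := by field_simp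
        rw [e1, Nat.cast_add_one, add_div, sub_add_eq_sub_sub, sub_add_cancel] at this
        rw [Nat.cast_add_one, add_div, sub_add_eq_sub_sub]
        exact this
      have hv2 : ‖f v‖ ^ 2 / (1 / (1 + C * ρ ^ 2) - ((∅ : Finset V).card : ℝ) / (C + 1))
          = ‖f v‖ ^ 2 + C * (ρ ^ 2 * ‖f v‖ ^ 2) := by
        rw [Finset.card_empty, Nat.cast_zero, zero_div, sub_zero, div_div_eq_mul_div]
        ring
      rw [hv2]
      have := mul_le_mul_of_nonneg_left hh2 hC
      linarith

/-! ### Rooted trees -/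

/-- A rooted tree: every vertex `v` other than the root has a parent `u`, and the edge between them
cuts off a set `B` of vertices that contains `v` and otherwise only vertices farther from the root
than `v`. -/
theorem SimpleGraph.IsTree.exists_parent {V : Type*} {G : SimpleGraph V} (hG : G.IsTree) (r v : V)
    (hv : v ≠ r) : ∃ u, G.Adj u v ∧ G.dist r u < G.dist r v ∧ ∃ B : Set V, v ∈ B ∧ u ∉ B ∧
      (∀ a b, G.Adj a b → a ∉ B → b ∈ B → a = u ∧ b = v) ∧
      ∀ w, w ≠ v → G.dist r w ≤ G.dist r v → w ∉ B := by
  have hconn := hG.connected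
  obtain ⟨u, huv, hu⟩ : ∃ u, G.Adj u v ∧ G.dist r u < G.dist r v := by
    obtain ⟨p, hp⟩ := hconn.exists_walk_length_eq_dist v r
    cases p with
    | nil => exact absurd rfl hv
    | @cons _ u _ h p =>
      refine ⟨u, h.symm, ?_⟩
      rw [SimpleGraph.dist_comm, SimpleGraph.dist_comm (u := r), ← hp, SimpleGraph.Walk.length_cons]
      exact Nat.lt_succ_of_le (SimpleGraph.dist_le p)
  have hbridge : ¬ (G.deleteEdges {s(u, v)}).Reachable u v :=
    SimpleGraph.isBridge_iff.1
      (SimpleGraph.isAcyclic_iff_forall_adj_isBridge.1 hG.isAcyclic huv)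
  have hcross : ∀ a b, G.Adj a b → ¬ (G.deleteEdges {s(u, v)}).Reachable v a →
      (G.deleteEdges {s(u, v)}).Reachable v b → a = u ∧ b = v := by
    intro a b hab ha hb
    by_cases he : s(a, b) = s(u, v)
    · rw [Sym2.eq_iff] at he
      rcases he with h | ⟨rfl, rfl⟩
      · exact h
      · exact absurd (SimpleGraph.Reachable.refl _) ha
    · refine absurd (hb.trans (SimpleGraph.Adj.reachable ?_)) ha
      rw [SimpleGraph.deleteEdges_adj]
      exact ⟨hab.symm, by rwa [Set.mem_singleton_iff, Sym2.eq_swap]⟩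
  -- a geodesic that crosses the cut visits `v`
  have hlen : ∀ a b (p : G.Walk a b), v ∈ p.support →
      G.dist a v + G.dist v b ≤ p.length := by
    classical
    intro a b p hvp
    rw [← p.take_spec hvp, SimpleGraph.Walk.length_append]
    exact add_le_add (SimpleGraph.dist_le _) (SimpleGraph.dist_le _)
  have hr : ¬ (G.deleteEdges {s(u, v)}).Reachable v r := by
    intro hrB
    obtain ⟨p, hp⟩ := hconn.exists_walk_length_eq_dist r u
    obtain ⟨d, hd, hd1, hd2⟩ := p.exists_boundary_dart
      {w | (G.deleteEdges {s(u, v)}).Reachable v w} hrB fun h => hbridge h.symm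
    have := hcross _ _ d.adj.symm hd2 hd1
    have h1 := hlen _ _ p (this.2 ▸ p.dart_fst_mem_support_of_mem_darts hd)
    omega
  refine ⟨u, huv, hu, {w | (G.deleteEdges {s(u, v)}).Reachable v w},
    SimpleGraph.Reachable.refl _, fun h => hbridge h.symm, hcross, ?_⟩
  intro w hwv hw hwB
  obtain ⟨p, hp⟩ := hconn.exists_walk_length_eq_dist r w
  obtain ⟨d, hd, hd1, hd2⟩ := p.exists_boundary_dart
    {w | ¬ (G.deleteEdges {s(u, v)}).Reachable v w} hr fun h => h hwB
  have := hcross _ _ d.adj hd1 (not_not.1 hd2)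
  have h1 := hlen _ _ p (this.2 ▸ p.dart_snd_mem_support_of_mem_darts hd)
  have h2 := hconn.pos_dist_of_ne hwv.symm
  omega

/-! ### Recoloring and independence across a cut -/

open Classical in
/-- The finite set of proper `L`-list-colorings of `G`. -/
noncomputable def listColorings {V : Type*} [Fintype V] (G : SimpleGraph V) {q : ℕ}
    (L : V → Finset (Fin q)) : Finset (V → Fin q) :=
  Finset.univ.filter fun σ => IsProperListColoring G L σ

theorem mem_listColorings {V : Type*} [Fintype V] {G : SimpleGraph V} {q : ℕ}
    {L : V → Finset (Fin q)} {σ : V → Fin q} :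
    σ ∈ listColorings G L ↔ (∀ v, σ v ∈ L v) ∧ ∀ u v, G.Adj u v → σ u ≠ σ v := by
  classical
  rw [listColorings, Finset.mem_filter]
  exact ⟨fun h => h.2, fun h => ⟨Finset.mem_univ σ, h⟩⟩

open Classical in
/-- Recoloring a vertex: a vertex with at least `β + 1` more colors than neighbors has a given
color with odds at most `1 / β`. -/
theorem mul_card_color_eq_le {V : Type*} [Fintype V] (G : SimpleGraph V) {q : ℕ}
    (L : V → Finset (Fin q)) {β : ℝ} (v : V)
    (hv : β + 1 + ((Finset.univ.filter (G.Adj v)).card : ℝ) ≤ ((L v).card : ℝ)) (c : Fin q) :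
    β * ((listColorings G L).filter fun σ => σ v = c).card
      ≤ ((listColorings G L).filter fun σ => σ v ≠ c).card := by
  let avail : (V → Fin q) → Finset (Fin q) := fun σ =>
    (L v \ (Finset.univ.filter (G.Adj v)).image σ).erase c
  have hav : ∀ σ, β ≤ (avail σ).card := by
    intro σ
    have h1 : (L v).card ≤ (avail σ).card + 1 + (Finset.univ.filter (G.Adj v)).card := by
      have h2 := Finset.le_card_sdiff ((Finset.univ.filter (G.Adj v)).image σ) (L v)
      have h3 : (L v \ (Finset.univ.filter (G.Adj v)).image σ).card ≤ (avail σ).card + 1 :=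
        tsub_le_iff_right.1 Finset.pred_card_le_card_erase
      have h4 : ((Finset.univ.filter (G.Adj v)).image σ).card
        ≤ (Finset.univ.filter (G.Adj v)).card := Finset.card_image_le
      omega
    have h5 : ((L v).card : ℝ) ≤ (avail σ).card + 1 + (Finset.univ.filter (G.Adj v)).card := by
      exact_mod_cast h1
    linarith
  have hcard : (((listColorings G L).filter fun σ => σ v = c).sigma avail).card
      ≤ ((listColorings G L).filter fun σ => σ v ≠ c).card := by
    refine Finset.card_le_card_of_injOn (fun x => Function.update x.1 v x.2) ?_ ?_
    · rintro ⟨σ, a⟩ hx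
      simp only [Finset.coe_sigma, Set.mem_sigma_iff, Finset.mem_coe, Finset.mem_filter, avail,
        Finset.mem_erase, Finset.mem_sdiff, Finset.mem_image, Finset.mem_univ, true_and,
        mem_listColorings] at hx ⊢
      obtain ⟨⟨⟨hL, hP⟩, -⟩, hac, haL, han⟩ := hx
      refine ⟨⟨fun w => ?_, fun x y hxy => ?_⟩, by simpa using hac⟩
      · by_cases hw : w = v
        · subst hw; simpa using haL
        · simpa [hw] using hL w
      · by_cases hx : x = v
        · subst hx
          have hy : y ≠ x := hxy.ne'
          simp only [Function.update_self, Function.update_of_ne hy]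
          exact fun h => han ⟨y, hxy, h.symm⟩
        · by_cases hy : y = v
          · subst hy
            simp only [Function.update_self, Function.update_of_ne hx]
            exact fun h => han ⟨x, hxy.symm, h⟩
          · simpa [hx, hy] using hP x y hxy
    · rintro ⟨σ, a⟩ hx ⟨σ', a'⟩ hx' h
      simp only [Finset.coe_sigma, Set.mem_sigma_iff, Finset.mem_coe, Finset.mem_filter] at hx hx'
      have ha : a = a' := by simpa using congrFun h v
      have hσ : σ = σ' := by
        funext w
        by_cases hw : w = v
        · rw [hw, hx.1.2, hx'.1.2]
        · simpa [hw] using congrFun h w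
      rw [ha, hσ]
  calc β * ((listColorings G L).filter fun σ => σ v = c).card
      = ∑ σ ∈ (listColorings G L).filter fun σ => σ v = c, β := by
        rw [Finset.sum_const, nsmul_eq_mul, mul_comm]
    _ ≤ ∑ σ ∈ (listColorings G L).filter fun σ => σ v = c, ((avail σ).card : ℝ) :=
        Finset.sum_le_sum fun σ _ => hav σ
    _ ≤ _ := by
        rw [← Nat.cast_sum, ← Finset.card_sigma]
        exact_mod_cast hcard

/-- In a random coloring, the two sides of a cut without edges are independent. -/
theorem card_mul_sum_mul_eq {V : Type*} [Fintype V] (G : SimpleGraph V) {q : ℕ}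
    (L : V → Finset (Fin q)) (B : Set V) (hB : ∀ a b, G.Adj a b → a ∉ B → b ∉ B)
    (f g : (V → Fin q) → ℝ) (hf : ∀ σ σ', (∀ w ∈ B, σ w = σ' w) → f σ = f σ')
    (hg : ∀ σ σ', (∀ w, w ∉ B → σ w = σ' w) → g σ = g σ') :
    ((listColorings G L).card : ℝ) * ∑ σ ∈ listColorings G L, f σ * g σ
      = (∑ σ ∈ listColorings G L, f σ) * ∑ σ ∈ listColorings G L, g σ := by
  classical
  let mix : (V → Fin q) → (V → Fin q) → V → Fin q := fun σ σ' w => if w ∈ B then σ w else σ' w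
  have hmix : ∀ σ ∈ listColorings G L, ∀ σ' ∈ listColorings G L,
      mix σ σ' ∈ listColorings G L := by
    intro σ hσ σ' hσ'
    rw [mem_listColorings] at hσ hσ' ⊢
    refine ⟨fun w => ?_, fun a b hab => ?_⟩
    · by_cases hw : w ∈ B
      · simpa [mix, hw] using hσ.1 w
      · simpa [mix, hw] using hσ'.1 w
    · by_cases ha : a ∈ B
      · have hb : b ∈ B := by
          by_contra hb
          exact hB b a hab.symm hb ha
        simpa [mix, ha, hb] using hσ.2 a b hab
      · simpa [mix, ha, hB a b hab ha] using hσ'.2 a b hab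
  rw [Finset.sum_mul_sum, ← Finset.sum_product', ← nsmul_eq_mul, ← Finset.sum_const,
    Finset.sum_comm]
  rw [← Finset.sum_product' (f := fun σ _ => f σ * g σ)]
  refine Finset.sum_nbij' (fun x => (mix x.1 x.2, mix x.2 x.1))
    (fun x => (mix x.1 x.2, mix x.2 x.1)) ?_ ?_ ?_ ?_ ?_
  · intro x hx
    rw [Finset.mem_product] at hx ⊢
    exact ⟨hmix _ hx.1 _ hx.2, hmix _ hx.2 _ hx.1⟩
  · intro x hx
    rw [Finset.mem_product] at hx ⊢
    exact ⟨hmix _ hx.1 _ hx.2, hmix _ hx.2 _ hx.1⟩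
  · intro x _
    ext w <;> by_cases hw : w ∈ B <;> simp [mix, hw]
  · intro x _
    ext w <;> by_cases hw : w ∈ B <;> simp [mix, hw]
  · intro x _
    rw [hf (mix x.1 x.2) x.1 fun w hw => by simp [mix, hw],
      hg (mix x.2 x.1) x.1 fun w hw => by simp [mix, hw]]

/-! ### Correlation along an edge -/

/-- The contraction estimate behind the correlation bound, for independent colors with weights `a`
and `b` of total mass `M`, conditioned to be different. If `φ` is a centered function of the second
color, then its conditional mean `h` given the first color has norm at most `‖φ‖ / β`. -/
theorem sq_mul_sum_condMean_sq_le {ι : Type*} [Fintype ι] (a b φ h : ι → ℝ) {M β : ℝ}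
    (hM : 0 < M) (hβ : 1 ≤ β) (ha0 : ∀ c, 0 ≤ a c) (hb0 : ∀ c, 0 ≤ b c)
    (ha : ∑ c, a c = M) (hb : ∑ c, b c = M)
    (hβa : ∀ c, β * a c ≤ M - a c) (hβb : ∀ c, β * b c ≤ M - b c)
    (hφ : ∑ c, b c * (M - a c) * φ c = 0)
    (hh : ∀ c, h c * (M - b c) = ∑ d, b d * φ d - b c * φ c) :
    β ^ 2 * ∑ c, a c * (M - b c) * h c ^ 2 ≤ ∑ c, b c * (M - a c) * φ c ^ 2 := by
  -- recentering `φ` at its mean under `b` alone makes the conditional mean local in the color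
  obtain ⟨κ, hκ⟩ : ∃ κ, κ * M = ∑ d, b d * φ d := ⟨(∑ d, b d * φ d) / M, by field_simp⟩
  have hlocal : ∀ c, (h c - κ) * (M - b c) = - (b c * (φ c - κ)) := by
    intro c
    have := hh c
    linear_combination this - hκ
  have hpos : ∀ c, 0 < M - b c := by
    intro c
    rcases (hb0 c).eq_or_lt with h0 | h0
    · rw [← h0]; linarith
    · have := hβb c
      have : 0 < β * b c := by positivity
      linarith
  have hN : ∑ c, a c * (M - b c) = ∑ c, b c * (M - a c) := by
    simp only [mul_sub, Finset.sum_sub_distrib, ← Finset.sum_mul, ha, hb]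
    simp only [mul_comm]
  have hN0 : 0 ≤ ∑ c, a c * (M - b c) :=
    Finset.sum_nonneg fun c _ => mul_nonneg (ha0 c) (hpos c).le
  have hmean : ∑ c, a c * (M - b c) * h c = 0 := by
    have : ∀ c, a c * (M - b c) * h c = a c * ∑ d, b d * φ d - a c * b c * φ c := by
      intro c
      linear_combination a c * hh c
    simp only [this, Finset.sum_sub_distrib, ← Finset.sum_mul, ha]
    rw [← hφ, Finset.mul_sum, ← Finset.sum_sub_distrib]
    exact Finset.sum_congr rfl fun c _ => by ring
  have hX : ∑ c, a c * (M - b c) * (h c - κ) ^ 2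
      = ∑ c, a c * (M - b c) * h c ^ 2 + κ ^ 2 * ∑ c, a c * (M - b c) := by
    have : ∀ c, a c * (M - b c) * (h c - κ) ^ 2 = a c * (M - b c) * h c ^ 2
        - 2 * κ * (a c * (M - b c) * h c) + κ ^ 2 * (a c * (M - b c)) := fun c => by ring
    simp only [this, Finset.sum_add_distrib, Finset.sum_sub_distrib]
    rw [← Finset.mul_sum, hmean, ← Finset.mul_sum]
    ring
  have hY : ∑ c, b c * (M - a c) * (φ c - κ) ^ 2
      = ∑ c, b c * (M - a c) * φ c ^ 2 + κ ^ 2 * ∑ c, b c * (M - a c) := by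
    have : ∀ c, b c * (M - a c) * (φ c - κ) ^ 2 = b c * (M - a c) * φ c ^ 2
        - 2 * κ * (b c * (M - a c) * φ c) + κ ^ 2 * (b c * (M - a c)) := fun c => by ring
    simp only [this, Finset.sum_add_distrib, Finset.sum_sub_distrib]
    rw [← Finset.mul_sum, hφ, ← Finset.mul_sum]
    ring
  have hXY : β ^ 2 * ∑ c, a c * (M - b c) * (h c - κ) ^ 2
      ≤ ∑ c, b c * (M - a c) * (φ c - κ) ^ 2 := by
    rw [Finset.mul_sum]
    refine Finset.sum_le_sum fun c _ => le_of_mul_le_mul_left ?_ (hpos c)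
    have e : (M - b c) * (β ^ 2 * (a c * (M - b c) * (h c - κ) ^ 2))
        = b c * (φ c - κ) ^ 2 * ((β * a c) * (β * b c)) := by
      linear_combination β ^ 2 * a c * ((h c - κ) * (M - b c) - b c * (φ c - κ)) * hlocal c
    rw [e]
    have h1 : (β * a c) * (β * b c) ≤ (M - a c) * (M - b c) :=
      mul_le_mul (hβa c) (hβb c) (mul_nonneg (by linarith) (hb0 c))
        (le_trans (mul_nonneg (by linarith) (ha0 c)) (hβa c))
    have h2 := mul_le_mul_of_nonneg_left h1 (mul_nonneg (hb0 c) (sq_nonneg (φ c - κ)))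
    linarith
  rw [hX, hY, ← hN, mul_add] at hXY
  have : κ ^ 2 * ∑ c, a c * (M - b c) ≤ β ^ 2 * (κ ^ 2 * ∑ c, a c * (M - b c)) :=
    le_mul_of_one_le_left (by positivity) (one_le_pow₀ hβ)
  linarith

theorem filter_adj_deleteEdges_card_lt {V : Type*} [Fintype V] [DecidableEq V] (G : SimpleGraph V)
    {u v : V} (huv : G.Adj u v) [DecidablePred (G.Adj u)]
    [DecidablePred ((G.deleteEdges {s(u, v)}).Adj u)] :
    (Finset.univ.filter ((G.deleteEdges {s(u, v)}).Adj u)).card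
      < (Finset.univ.filter (G.Adj u)).card := by
  refine Finset.card_lt_card ⟨fun w hw => ?_, fun h => ?_⟩
  · simp only [Finset.mem_filter, Finset.mem_univ, true_and, SimpleGraph.deleteEdges_adj] at hw ⊢
    exact hw.1
  · have := h (Finset.mem_filter.2 ⟨Finset.mem_univ v, huv⟩)
    simp at this

theorem listColorings_eq_filter_deleteEdges {V : Type*} [Fintype V] (G : SimpleGraph V) {q : ℕ}
    (L : V → Finset (Fin q)) {u v : V} (huv : G.Adj u v) :
    listColorings G L
      = (listColorings (G.deleteEdges {s(u, v)}) L).filter fun σ => σ u ≠ σ v := by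
  ext σ
  simp only [Finset.mem_filter, mem_listColorings, SimpleGraph.deleteEdges_adj,
    Set.mem_singleton_iff]
  constructor
  · exact fun h => ⟨⟨h.1, fun x y hxy => h.2 x y hxy.1⟩, h.2 u v huv⟩
  · rintro ⟨⟨h1, h2⟩, h3⟩
    refine ⟨h1, fun x y hxy => ?_⟩
    by_cases he : s(x, y) = s(u, v)
    · rcases Sym2.eq_iff.1 he with ⟨rfl, rfl⟩ | ⟨rfl, rfl⟩
      · exact h3
      · exact h3.symm
    · exact h2 x y ⟨hxy, he⟩

/-- Summation over the colorings of `G` by way of the product structure of the colorings of `G`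
without the edge `uv`. -/
theorem card_mul_sum_edge_eq {V : Type*} [Fintype V] (G : SimpleGraph V) {q : ℕ}
    (L : V → Finset (Fin q)) {u v : V} (huv : G.Adj u v) (B : Set V) (hv : v ∈ B) (hu : u ∉ B)
    (hB : ∀ a b, G.Adj a b → a ∉ B → b ∈ B → a = u ∧ b = v)
    (Φ : Fin q → Fin q → ℝ) (g : (V → Fin q) → ℝ)
    (hg : ∀ σ σ', (∀ w, w ∉ B → σ w = σ' w) → g σ = g σ') :
    ((listColorings (G.deleteEdges {s(u, v)}) L).card : ℝ)
        * ∑ σ ∈ listColorings G L, Φ (σ u) (σ v) * g σ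
      = ∑ c, (∑ σ ∈ listColorings (G.deleteEdges {s(u, v)}) L,
          if σ v ≠ c then Φ c (σ v) else 0)
        * ∑ σ ∈ listColorings (G.deleteEdges {s(u, v)}) L, if σ u = c then g σ else 0 := by
  have hB' : ∀ a b, (G.deleteEdges {s(u, v)}).Adj a b → a ∉ B → b ∉ B := by
    intro a b hab ha hb
    rw [SimpleGraph.deleteEdges_adj] at hab
    obtain ⟨rfl, rfl⟩ := hB a b hab.1 ha hb
    exact hab.2 rfl
  have hprod := fun c => card_mul_sum_mul_eq _ L B hB'
    (fun σ => if σ v ≠ c then Φ c (σ v) else 0) (fun σ => if σ u = c then g σ else 0)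
    (fun σ σ' h => by simp only [h v hv])
    (fun σ σ' h => by simp only [h u hu, hg σ σ' h])
  rw [← Finset.sum_congr rfl fun c _ => hprod c, ← Finset.mul_sum, Finset.sum_comm,
    listColorings_eq_filter_deleteEdges G L huv, Finset.sum_filter]
  congr 1
  refine Finset.sum_congr rfl fun σ _ => ?_
  rw [Finset.sum_eq_single (σ u)]
  · by_cases h : σ u = σ v
    · simp [h]
    · simp [h, Ne.symm h]
  · intro c _ hc
    rw [if_neg (Ne.symm hc), mul_zero]
  · simp

open Classical in
/-- The conditional mean, given the color of `u`, of a centered function of the color of `v`,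
for an edge `uv` that cuts off the side `B` of `v`: it carries all correlations with the other side
(the Markov property), and its norm is smaller by the factor `β`. -/
theorem exists_condMean {V : Type*} [Fintype V] (G : SimpleGraph V) {q : ℕ}
    (L : V → Finset (Fin q)) {u v : V} (huv : G.Adj u v) (B : Set V) (hvB : v ∈ B) (huB : u ∉ B)
    (hB : ∀ a b, G.Adj a b → a ∉ B → b ∈ B → a = u ∧ b = v) {β : ℝ} (hβ : 0 < β)
    (hL : ∀ w, (L w).card ≤ 1 ∨
      β + ((Finset.univ.filter (G.Adj w)).card : ℝ) ≤ ((L w).card : ℝ))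
    (φ : Fin q → ℝ) (hφ : ∑ σ ∈ listColorings G L, φ (σ v) = 0) :
    ∃ h : Fin q → ℝ, ∑ σ ∈ listColorings G L, h (σ u) = 0 ∧
      (∀ g : (V → Fin q) → ℝ, (∀ σ σ', (∀ w, w ∉ B → σ w = σ' w) → g σ = g σ') →
        ∑ σ ∈ listColorings G L, φ (σ v) * g σ = ∑ σ ∈ listColorings G L, h (σ u) * g σ) ∧
      β ^ 2 * ∑ σ ∈ listColorings G L, h (σ u) ^ 2 ≤ ∑ σ ∈ listColorings G L, φ (σ v) ^ 2 := by
  rcases (listColorings (G.deleteEdges {s(u, v)}) L).eq_empty_or_nonempty with hempty | hne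
  · have : listColorings G L = ∅ := by
      rw [listColorings_eq_filter_deleteEdges G L huv, hempty, Finset.filter_empty]
    exact ⟨0, by simp [this]⟩
  have hsum := card_mul_sum_edge_eq G L huv B hvB huB hB
  set Ω := listColorings G L with hΩ
  set Ω' := listColorings (G.deleteEdges {s(u, v)}) L with hΩ'
  have hM : (0 : ℝ) < Ω'.card := by exact_mod_cast hne.card_pos
  set h : Fin q → ℝ := fun c => (∑ σ ∈ Ω', if σ v ≠ c then φ (σ v) else 0)
    / ∑ σ ∈ Ω', if σ v ≠ c then 1 else 0 with hh
  have hhc : ∀ c, h c * (∑ σ ∈ Ω', if σ v ≠ c then 1 else 0)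
      = ∑ σ ∈ Ω', if σ v ≠ c then φ (σ v) else 0 := by
    intro c
    by_cases h0 : (∑ σ ∈ Ω', if σ v ≠ c then (1 : ℝ) else 0) = 0
    · rw [h0, mul_zero]
      rw [Finset.sum_eq_zero_iff_of_nonneg (fun σ _ => by split_ifs <;> norm_num)] at h0
      refine (Finset.sum_eq_zero fun σ hσ => ?_).symm
      have := h0 σ hσ
      by_cases hc : σ v ≠ c
      · simp [hc] at this
      · rw [if_neg hc]
    · rw [hh]
      exact div_mul_cancel₀ _ h0
  have hproj : ∀ g : (V → Fin q) → ℝ, (∀ σ σ', (∀ w, w ∉ B → σ w = σ' w) → g σ = g σ') →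
      ∑ σ ∈ Ω, φ (σ v) * g σ = ∑ σ ∈ Ω, h (σ u) * g σ := by
    intro g hg
    refine mul_left_cancel₀ hM.ne' ?_
    rw [hsum (fun _ d => φ d) g hg, hsum (fun c _ => h c) g hg]
    refine Finset.sum_congr rfl fun c _ => ?_
    rw [← hhc c]
    congr 1
    rw [Finset.mul_sum]
    exact Finset.sum_congr rfl fun σ _ => by split_ifs <;> simp
  have hmean : ∑ σ ∈ Ω, h (σ u) = 0 := by
    have := hproj (fun _ => 1) fun _ _ _ => rfl
    simpa [hφ] using this.symm
  have hself : ∑ σ ∈ Ω, φ (σ v) * h (σ u) = ∑ σ ∈ Ω, h (σ u) ^ 2 := by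
    rw [hproj (fun σ => h (σ u)) fun σ σ' e => by simp only [e u huB]]
    exact Finset.sum_congr rfl fun σ _ => (sq _).symm
  refine ⟨h, hmean, hproj, ?_⟩
  have hφ2 : 0 ≤ ∑ σ ∈ Ω, φ (σ v) ^ 2 := Finset.sum_nonneg fun _ _ => sq_nonneg _
  -- a centered function of a color that is the same in all colorings vanishes
  have hconst : ∀ w (ψ : Fin q → ℝ), (L w).card ≤ 1 → ∑ σ ∈ Ω, ψ (σ w) = 0 →
      ∀ σ ∈ Ω, ψ (σ w) = 0 := by
    intro w ψ hw hψ σ hσ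
    have hall : ∀ σ' ∈ Ω, ψ (σ' w) = ψ (σ w) := fun σ' hσ' => by
      rw [Finset.card_le_one.1 hw _ ((mem_listColorings.1 hσ').1 w) _
        ((mem_listColorings.1 hσ).1 w)]
    rw [Finset.sum_congr rfl hall, Finset.sum_const, nsmul_eq_mul] at hψ
    have : (Ω.card : ℝ) ≠ 0 := by exact_mod_cast (Finset.card_pos.2 ⟨σ, hσ⟩).ne'
    exact (mul_eq_zero.1 hψ).resolve_left this
  by_cases hu1 : (L u).card ≤ 1
  · have h0 := hconst u h hu1 hmean
    rw [Finset.sum_eq_zero fun σ hσ => by rw [h0 σ hσ]; ring, mul_zero]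
    exact hφ2
  by_cases hv1 : (L v).card ≤ 1
  · have h0 := hconst v φ hv1 hφ
    rw [← hself, Finset.sum_eq_zero fun σ hσ => by rw [h0 σ hσ, zero_mul], mul_zero]
    exact hφ2
  rcases le_total β 1 with hβ1 | hβ1
  · -- the projection is a contraction in any case
    have hh2 : 0 ≤ ∑ σ ∈ Ω, h (σ u) ^ 2 := Finset.sum_nonneg fun _ _ => sq_nonneg _
    have h1 : ∑ σ ∈ Ω, φ (σ v) * h (σ u)
        ≤ ∑ σ ∈ Ω, (φ (σ v) ^ 2 / 2 + h (σ u) ^ 2 / 2) :=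
      Finset.sum_le_sum fun σ _ => by nlinarith [sq_nonneg (φ (σ v) - h (σ u))]
    rw [hself, Finset.sum_add_distrib, ← Finset.sum_div, ← Finset.sum_div] at h1
    have h2 : β ^ 2 * ∑ σ ∈ Ω, h (σ u) ^ 2 ≤ ∑ σ ∈ Ω, h (σ u) ^ 2 :=
      mul_le_of_le_one_left hh2 (pow_le_one₀ hβ.le hβ1)
    linarith
  set M : ℝ := (Ω'.card : ℝ) with hMdef
  set a : Fin q → ℝ := fun c => ((Ω'.filter fun σ => σ u = c).card : ℝ) with ha
  set b : Fin q → ℝ := fun c => ((Ω'.filter fun σ => σ v = c).card : ℝ) with hb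
  have hfib : ∀ (w : V) (ψ : Fin q → ℝ), ∑ σ ∈ Ω', ψ (σ w)
      = ∑ c, ((Ω'.filter fun σ => σ w = c).card : ℝ) * ψ c := by
    intro w ψ
    rw [← Finset.sum_fiberwise Ω' (fun σ => σ w)]
    refine Finset.sum_congr rfl fun c _ => ?_
    rw [Finset.sum_congr rfl fun σ hσ => by rw [(Finset.mem_filter.1 hσ).2], Finset.sum_const,
      nsmul_eq_mul]
  have hone : ∀ (w : V) (c : Fin q) (x : ℝ), (∑ σ ∈ Ω', if σ w = c then x else 0)
      = ((Ω'.filter fun σ => σ w = c).card : ℝ) * x := by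
    intro w c x
    rw [← Finset.sum_filter, Finset.sum_const, nsmul_eq_mul]
  have hne' : ∀ c (ψ : Fin q → ℝ), (∑ σ ∈ Ω', if σ v ≠ c then ψ (σ v) else 0)
      = ∑ d, b d * ψ d - b c * ψ c := by
    intro c ψ
    rw [← hfib v ψ, ← hone v c (ψ c), ← Finset.sum_sub_distrib]
    refine Finset.sum_congr rfl fun σ _ => ?_
    by_cases hc : σ v = c <;> simp [hc]
  have hbM : ∑ c, b c = M := by
    have := hfib v fun _ => 1
    simpa [hb] using this.symm
  have haM : ∑ c, a c = M := by
    have := hfib u fun _ => 1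
    simpa [ha] using this.symm
  have hsum_u : ∀ ψ : Fin q → ℝ, M * ∑ σ ∈ Ω, ψ (σ u) = ∑ c, a c * (M - b c) * ψ c := by
    intro ψ
    have := hsum (fun c _ => ψ c) (fun _ => 1) fun _ _ _ => rfl
    simp only [mul_one] at this
    rw [this]
    refine Finset.sum_congr rfl fun c _ => ?_
    rw [hone u c 1, hne' c fun _ => ψ c, ← Finset.sum_mul, hbM]
    ring
  have hsum_v : ∀ ψ : Fin q → ℝ, M * ∑ σ ∈ Ω, ψ (σ v) = ∑ c, b c * (M - a c) * ψ c := by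
    intro ψ
    have := hsum (fun _ d => ψ d) (fun _ => 1) fun _ _ _ => rfl
    simp only [mul_one] at this
    rw [this]
    simp only [hone u _ 1, hne' _ ψ]
    change ∑ c, (∑ d, b d * ψ d - b c * ψ c) * (a c * 1) = _
    simp only [sub_mul, mul_one, Finset.sum_sub_distrib, ← Finset.mul_sum, haM, mul_sub]
    rw [Finset.sum_mul]
    congr 1 <;> exact Finset.sum_congr rfl fun c _ => by ring
  have hodds : ∀ w w', G.Adj w w' → s(w, w') = s(u, v) → ¬ (L w).card ≤ 1 → ∀ c,
      β * ((Ω'.filter fun σ => σ w = c).card : ℝ)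
        ≤ M - ((Ω'.filter fun σ => σ w = c).card : ℝ) := by
    intro w w' hww' he hw c
    have h1 := mul_card_color_eq_le (G.deleteEdges {s(u, v)}) L (β := β) w (by
      refine le_trans ?_ ((hL w).resolve_left hw)
      rw [add_assoc, add_comm (1 : ℝ)]
      refine add_le_add le_rfl ?_
      rw [← he]
      norm_cast
      refine Nat.succ_le_of_lt ?_
      convert filter_adj_deleteEdges_card_lt G hww') c
    have h2 : ((Ω'.filter fun σ => σ w = c).card : ℝ) + (Ω'.filter fun σ => σ w ≠ c).card = M := by
      rw [hMdef, ← Finset.card_filter_add_card_filter_not (s := Ω') fun σ => σ w = c]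
      push_cast
      rfl
    linarith
  have key := sq_mul_sum_condMean_sq_le a b φ h hM hβ1 (fun c => Nat.cast_nonneg _)
    (fun c => Nat.cast_nonneg _) haM hbM (hodds u v huv rfl hu1)
    (hodds v u huv.symm Sym2.eq_swap hv1) (by rw [← hsum_v, hφ, mul_zero])
    (fun c => by
      have := hhc c
      rw [hne' c φ, hne' c fun _ => 1] at this
      simpa [hbM] using this)
  rw [← hsum_u fun c => h c ^ 2, ← hsum_v fun c => φ c ^ 2] at key
  refine le_of_mul_le_mul_left ?_ hM
  linarith

/-! ### Variance of sums over a random coloring -/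

/-- The space of centered functions of the color of `v`, for a random element of `Ω`. -/
def colorFunctions {V : Type*} {q : ℕ} (Ω : Finset (V → Fin q)) (v : V) :
    Submodule ℝ (EuclideanSpace ℝ Ω) where
  carrier := {x | ∃ φ : Fin q → ℝ, (∀ σ : Ω, x σ = φ (σ.1 v)) ∧ ∑ σ ∈ Ω, φ (σ v) = 0}
  zero_mem' := ⟨0, by simp⟩
  add_mem' := by
    rintro x y ⟨φ, hφ, hφ0⟩ ⟨ψ, hψ, hψ0⟩
    exact ⟨φ + ψ, by simp [hφ, hψ], by simp [Finset.sum_add_distrib, hφ0, hψ0]⟩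
  smul_mem' := by
    rintro a x ⟨φ, hφ, hφ0⟩
    exact ⟨a • φ, by simp [hφ], by simp [← Finset.mul_sum, hφ0]⟩

open Classical in
/-- Variance bound for sums of functions of the single colors in a random list coloring of a tree.
-/
theorem sum_sq_le_of_centered {V : Type*} [Fintype V] (G : SimpleGraph V) (hG : G.IsTree) {q : ℕ}
    (L : V → Finset (Fin q)) {β C l : ℝ} (hβ : 0 < β) (hC : 0 ≤ C) (hl : 0 < l) {Δ : ℕ}
    (hΔ : ∀ v, (Finset.univ.filter (G.Adj v)).card ≤ Δ)
    (hroot : 1 / l ≤ 1 - (Δ : ℝ) / (C + 1))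
    (hother : 1 / l ≤ 1 / (1 + C * β⁻¹ ^ 2) - ((Δ : ℝ) - 1) / (C + 1))
    (hL : ∀ w, (L w).card ≤ 1 ∨
      β + ((Finset.univ.filter (G.Adj w)).card : ℝ) ≤ ((L w).card : ℝ))
    (f : V → Fin q → ℝ) (hf : ∀ v, ∑ σ ∈ listColorings G L, f v (σ v) = 0) :
    ∑ σ ∈ listColorings G L, (∑ v, f v (σ v)) ^ 2
      ≤ l * ∑ σ ∈ listColorings G L, ∑ v, f v (σ v) ^ 2 := by
  set Ω := listColorings G L with hΩ
  have hC1 : 0 < C + 1 := by linarith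
  obtain ⟨r⟩ := hG.connected.nonempty
  have hex := fun v => hG.exists_parent r v
  choose! parent hadj hdepth B hvB huB hB hfar using hex
  let H := colorFunctions Ω
  have hproj : ∀ v, v ≠ r → ∀ x ∈ H v, ∃ y ∈ H (parent v), ‖y‖ ≤ β⁻¹ * ‖x‖ ∧
      ∀ w, w ≠ v → G.dist r w ≤ G.dist r v → ∀ g ∈ H w, inner ℝ (x - y) g = 0 := by
    rintro v hv x ⟨φ, hx, hφ⟩
    obtain ⟨h, hh0, hh, hle⟩ := exists_condMean G L (hadj v hv) (B v) (hvB v hv) (huB v hv)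
      (hB v hv) hβ hL φ hφ
    refine ⟨WithLp.toLp 2 fun σ : Ω => h (σ.1 (parent v)), ⟨h, fun σ => rfl, hh0⟩, ?_, ?_⟩
    · refine le_of_sq_le_sq ?_ (by positivity)
      rw [mul_pow, EuclideanSpace.real_norm_sq_eq, EuclideanSpace.real_norm_sq_eq, inv_pow,
        inv_mul_eq_div, le_div_iff₀ (by positivity), mul_comm]
      simp only [hx]
      rw [Finset.sum_coe_sort Ω fun σ => φ (σ v) ^ 2,
        Finset.sum_coe_sort Ω fun σ => h (σ (parent v)) ^ 2]
      exact hle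
    · rintro w hwv hw g ⟨ψ, hg, -⟩
      have := hh (fun σ => ψ (σ w)) fun σ σ' e => by simp only [e w (hfar v hv w hwv hw)]
      rw [PiLp.inner_apply]
      simp only [PiLp.sub_apply, hx, hg, RCLike.inner_apply, conj_trivial]
      rw [Finset.sum_coe_sort Ω fun σ => ψ (σ w) * (φ (σ v) - h (σ (parent v)))]
      simp only [mul_comm (ψ _), sub_mul, Finset.sum_sub_distrib]
      rw [this, sub_self]
  have hweight : ∀ v, 1 / l ≤ (if v = r then 1 else 1 / (1 + C * β⁻¹ ^ 2))
      - ((Finset.univ.filter fun w => w ≠ r ∧ parent w = v).card : ℝ) / (C + 1) := by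
    intro v
    have hsub : (Finset.univ.filter fun w => w ≠ r ∧ parent w = v)
        ⊆ Finset.univ.filter (G.Adj v) := by
      intro w hw
      simp only [Finset.mem_filter, Finset.mem_univ, true_and] at hw ⊢
      exact hw.2 ▸ hadj w hw.1
    split_ifs with hv
    · refine hroot.trans (sub_le_sub_left ?_ _)
      gcongr
      exact (Finset.card_le_card hsub).trans (hΔ v)
    · have hlt : (Finset.univ.filter fun w => w ≠ r ∧ parent w = v).card + 1 ≤ Δ := by
        refine le_trans (Nat.succ_le_of_lt (Finset.card_lt_card ⟨hsub, fun h => ?_⟩)) (hΔ v)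
        have h1 := h (Finset.mem_filter.2 ⟨Finset.mem_univ _, (hadj v hv).symm⟩)
        simp only [Finset.mem_filter, Finset.mem_univ, true_and] at h1
        have h2 := hdepth _ h1.1
        rw [h1.2] at h2
        exact lt_asymm h2 (hdepth v hv)
      have hlt' : ((Finset.univ.filter fun w => w ≠ r ∧ parent w = v).card : ℝ) ≤ (Δ : ℝ) - 1 := by
        rw [le_sub_iff_add_le]
        exact_mod_cast hlt
      refine hother.trans (sub_le_sub_left ?_ _)
      gcongr
  have hl' : 0 < 1 / l := by positivity
  let F : V → EuclideanSpace ℝ Ω := fun v => WithLp.toLp 2 fun σ : Ω => f v (σ.1 v)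
  have key := norm_sum_sq_le_of_rootedTree H r parent (G.dist r) (by simp) hdepth hC hproj
    Finset.univ (fun _ _ _ => Finset.mem_univ _) (fun v _ => hl'.trans_le (hweight v)) F
    (fun v => ⟨f v, fun _ => rfl, hf v⟩)
  have hnorm : ∀ v, ‖F v‖ ^ 2 = ∑ σ ∈ Ω, f v (σ v) ^ 2 := by
    intro v
    rw [EuclideanSpace.real_norm_sq_eq, ← Finset.sum_coe_sort Ω]
  have hnorm' : ‖∑ v, F v‖ ^ 2 = ∑ σ ∈ Ω, (∑ v, f v (σ v)) ^ 2 := by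
    rw [EuclideanSpace.real_norm_sq_eq, ← Finset.sum_coe_sort Ω]
    refine Finset.sum_congr rfl fun σ _ => ?_
    simp [F]
  rw [← hnorm', Finset.sum_comm, Finset.mul_sum]
  refine key.trans (Finset.sum_le_sum fun v _ => ?_)
  rw [← hnorm v, div_eq_mul_inv, mul_comm]
  refine mul_le_mul_of_nonneg_right ?_ (sq_nonneg _)
  rw [inv_le_comm₀ (hl'.trans_le (hweight v)) hl, ← one_div]
  exact hweight v

open Classical in
/-- Centering the summands one by one does not increase the sum of their squares, so that it is
enough that the whole sum is centered. -/
theorem sum_sq_le_of_sum_eq_zero {V : Type*} [Fintype V] (G : SimpleGraph V) (hG : G.IsTree)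
    {q : ℕ} (L : V → Finset (Fin q)) {β C l : ℝ} (hβ : 0 < β) (hC : 0 ≤ C) (hl : 0 < l) {Δ : ℕ}
    (hΔ : ∀ v, (Finset.univ.filter (G.Adj v)).card ≤ Δ)
    (hroot : 1 / l ≤ 1 - (Δ : ℝ) / (C + 1))
    (hother : 1 / l ≤ 1 / (1 + C * β⁻¹ ^ 2) - ((Δ : ℝ) - 1) / (C + 1))
    (hL : ∀ w, (L w).card ≤ 1 ∨
      β + ((Finset.univ.filter (G.Adj w)).card : ℝ) ≤ ((L w).card : ℝ))
    (f : V → Fin q → ℝ) (hf : ∑ σ ∈ listColorings G L, ∑ v, f v (σ v) = 0) :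
    ∑ σ ∈ listColorings G L, (∑ v, f v (σ v)) ^ 2
      ≤ l * ∑ σ ∈ listColorings G L, ∑ v, f v (σ v) ^ 2 := by
  rcases (listColorings G L).eq_empty_or_nonempty with h0 | hne
  · simp [h0]
  have hN : (0 : ℝ) < (listColorings G L).card := by exact_mod_cast hne.card_pos
  obtain ⟨m, hm⟩ : ∃ m : V → ℝ, ∀ v,
      m v * (listColorings G L).card = ∑ σ ∈ listColorings G L, f v (σ v) :=
    ⟨fun v => (∑ σ ∈ listColorings G L, f v (σ v)) / (listColorings G L).card,
      fun v => div_mul_cancel₀ _ hN.ne'⟩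
  have hm0 : ∑ v, m v = 0 := by
    refine (mul_eq_zero.1 ?_).resolve_right hN.ne'
    rw [Finset.sum_mul, Finset.sum_congr rfl fun v _ => hm v, Finset.sum_comm, hf]
  have key := sum_sq_le_of_centered G hG L hβ hC hl hΔ hroot hother hL (fun v c => f v c - m v)
    (fun v => by rw [Finset.sum_sub_distrib, ← hm v, Finset.sum_const, nsmul_eq_mul]; ring)
  simp only [Finset.sum_sub_distrib, hm0, sub_zero] at key
  refine key.trans (mul_le_mul_of_nonneg_left ?_ hl.le)
  rw [Finset.sum_comm, Finset.sum_comm (s := listColorings G L)]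
  refine Finset.sum_le_sum fun v _ => ?_
  have e : ∀ σ : V → Fin q, (f v (σ v) - m v) ^ 2
      = f v (σ v) ^ 2 - 2 * m v * f v (σ v) + m v ^ 2 := fun σ => by ring
  simp only [e, Finset.sum_add_distrib, Finset.sum_sub_distrib, ← Finset.mul_sum, ← hm v,
    Finset.sum_const, nsmul_eq_mul]
  nlinarith [mul_nonneg hN.le (sq_nonneg (m v))]

/-- The numerical conditions on the free parameter `C` of the variance recursion, met by
`C = β √(Δ - 1)`, or by `C = β` if `Δ = 1`. -/
theorem exists_recursion_parameter {Δ : ℕ} (hΔ1 : 1 ≤ Δ) {ε : ℝ} (hε : 0 < ε)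
    (h : Real.log Δ ^ 2 / Δ ≤ ε ^ 2 / 100) :
    ∃ C : ℝ, 0 ≤ C ∧ 1 / (1 + (1 / 20 + 1 / ε)) ≤ 1 - (Δ : ℝ) / (C + 1) ∧
      1 / (1 + (1 / 20 + 1 / ε))
        ≤ 1 / (1 + C * (ε * Δ)⁻¹ ^ 2) - ((Δ : ℝ) - 1) / (C + 1) := by
  rcases hΔ1.eq_or_lt with rfl | hΔ2
  · refine ⟨ε, hε.le, ?_, ?_⟩
    · rw [Nat.cast_one, one_sub_div (by positivity), div_le_div_iff₀ (by positivity)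
        (by positivity)]
      field_simp
      nlinarith
    · have e : ε * (ε * (1 : ℕ))⁻¹ ^ 2 = 1 / ε := by field_simp; simp
      rw [e]
      simp only [Nat.cast_one, sub_self, zero_div, sub_zero]
      gcongr
      linarith
  · have hΔ2' : (2 : ℝ) ≤ Δ := by exact_mod_cast hΔ2
    have hΔ0 : (0 : ℝ) < Δ := by linarith
    obtain ⟨s, hs⟩ : ∃ s, s = Real.sqrt ((Δ : ℝ) - 1) := ⟨_, rfl⟩
    have hs2 : s ^ 2 = (Δ : ℝ) - 1 := by rw [hs, Real.sq_sqrt (by linarith)]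
    have hs1 : 1 ≤ s := by rw [hs, Real.one_le_sqrt]; linarith
    have hD : (Δ : ℝ) = s ^ 2 + 1 := by linarith
    obtain ⟨t, ht⟩ : ∃ t, t = s / (ε * Δ) := ⟨_, rfl⟩
    have ht0 : 0 < t := by rw [ht]; positivity
    have htε : 2 * t ≤ 1 / ε := by
      rw [ht, hD, mul_div_assoc', div_le_div_iff₀ (by positivity) hε]
      nlinarith [mul_nonneg hε.le (sq_nonneg (s - 1))]
    have ht1 : t ≤ 11 / 100 := by
      -- the worst case is `Δ = 2`, with `100 (log 2)² / 2 > 24`; for larger `Δ` the logarithm is at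
      -- least `1`; the constant is right because `1 / 83 ≤ (11 / 100) ^ 2`
      have hlog : 83 * ((Δ : ℝ) - 1) ≤ ε ^ 2 * Δ ^ 2 := by
        rw [div_le_iff₀ hΔ0] at h
        rcases (Nat.succ_le_of_lt hΔ2).eq_or_lt with h2 | h3
        · have := Real.log_two_gt_d9
          have hc : (Δ : ℝ) = 2 := by exact_mod_cast h2.symm
          rw [hc] at h ⊢
          nlinarith
        · have h3' : (3 : ℝ) ≤ Δ := by exact_mod_cast h3
          have hl1 : 1 ≤ Real.log Δ := by
            rw [Real.le_log_iff_exp_le hΔ0]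
            exact Real.exp_one_lt_three.le.trans h3'
          nlinarith [mul_le_mul_of_nonneg_right (show 100 ≤ ε ^ 2 * Δ by nlinarith) hΔ0.le]
      refine le_of_sq_le_sq ?_ (by norm_num)
      rw [ht, div_pow, hs2, mul_pow, div_le_iff₀ (by positivity)]
      nlinarith
    have e1 : ε * Δ * s * (ε * Δ)⁻¹ ^ 2 = t := by rw [ht]; field_simp
    have e2 : ((Δ : ℝ) - 1) / (ε * Δ * s) = t := by rw [ht, ← hs2]; field_simp
    have hC0 : 0 < ε * Δ * s := by positivity
    have hD2 : ((Δ : ℝ) - 1) / (ε * Δ * s + 1) ≤ t := by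
      rw [← e2]
      exact div_le_div_of_nonneg_left (by linarith) hC0 (by linarith)
    have hmain : 1 / (1 + (1 / 20 + 1 / ε)) ≤ 1 / (1 + t) - t := by
      have h1 : 1 / (1 + (1 / 20 + 1 / ε)) ≤ 1 / (1 + (1 / 20 + 2 * t)) := by gcongr
      refine h1.trans ?_
      rw [le_sub_iff_add_le, div_add' _ _ _ (by positivity), div_le_div_iff₀ (by positivity)
        (by positivity)]
      nlinarith [mul_pos ht0 ht0, mul_nonneg ht0.le (sub_nonneg.2 ht1),
        mul_nonneg (mul_pos ht0 ht0).le (sub_nonneg.2 ht1)]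
    refine ⟨ε * Δ * s, hC0.le, ?_, ?_⟩
    · have h1 : (Δ : ℝ) / (ε * Δ * s + 1) = (Δ - 1) / (ε * Δ * s + 1) + 1 / (ε * Δ * s + 1) := by
        rw [← add_div, sub_add_cancel]
      have h2 : 1 / (1 + t) ≤ 1 - 1 / (ε * Δ * s + 1) := by
        rw [one_sub_div (by positivity), div_le_div_iff₀ (by positivity) (by positivity)]
        have : t * (ε * Δ * s) = s ^ 2 := by rw [ht]; field_simp
        nlinarith
      linarith
    · rw [e1]
      linarith

/-! ### Local walks of the coloring complex -/

/-- The lists that remain when the colors in `τ` are prescribed. -/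
def pinnedLists {V : Type*} [DecidableEq V] {q : ℕ} (L : V → Finset (Fin q))
    (τ : Finset (V × Fin q)) (v : V) : Finset (Fin q) :=
  (L v).filter fun c => ∀ c', (v, c') ∈ τ → c = c'

/-- The facet of a coloring. -/
def coloringFacet {V : Type*} [Fintype V] [DecidableEq V] {q : ℕ} (σ : V → Fin q) :
    Finset (V × Fin q) :=
  Finset.univ.image fun v => (v, σ v)

theorem mem_coloringFacet {V : Type*} [Fintype V] [DecidableEq V] {q : ℕ} {σ : V → Fin q}
    {x : V × Fin q} : x ∈ coloringFacet σ ↔ σ x.1 = x.2 := by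
  simp only [coloringFacet, Finset.mem_image, Finset.mem_univ, true_and]
  constructor
  · rintro ⟨v, rfl⟩; rfl
  · exact fun h => ⟨x.1, by rw [h]⟩

theorem coloringFacet_injective {V : Type*} [Fintype V] [DecidableEq V] {q : ℕ} :
    Function.Injective (coloringFacet : (V → Fin q) → Finset (V × Fin q)) := by
  intro σ σ' h
  funext v
  have : (v, σ v) ∈ coloringFacet σ' := h ▸ mem_coloringFacet.2 rfl
  exact (mem_coloringFacet.1 this).symm

theorem coloringFacets_eq_image {V : Type*} [Fintype V] [DecidableEq V] (G : SimpleGraph V)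
    {q : ℕ} (L : V → Finset (Fin q)) :
    coloringFacets G L = (listColorings G L).image coloringFacet := by
  ext s
  simp only [coloringFacets, listColorings, coloringFacet, Finset.mem_image, Finset.mem_filter,
    Finset.mem_univ, true_and]

theorem mem_listColorings_pinnedLists {V : Type*} [Fintype V] [DecidableEq V] {G : SimpleGraph V}
    {q : ℕ} {L : V → Finset (Fin q)} {τ : Finset (V × Fin q)} {σ : V → Fin q} :
    σ ∈ listColorings G (pinnedLists L τ) ↔ σ ∈ listColorings G L ∧ τ ⊆ coloringFacet σ := by
  simp only [mem_listColorings, pinnedLists, Finset.mem_filter]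
  constructor
  · exact fun h => ⟨⟨fun v => (h.1 v).1, h.2⟩, fun x hx =>
      mem_coloringFacet.2 ((h.1 x.1).2 x.2 hx)⟩
  · exact fun h => ⟨fun v => ⟨h.1.1 v, fun c' hc' => mem_coloringFacet.1 (h.2 hc')⟩, h.1.2⟩

/-- The total weight of the facets that extend `τ` and satisfy `p`. -/
theorem sum_uniformWeight_filter {V : Type*} [Fintype V] [DecidableEq V] (G : SimpleGraph V)
    {q : ℕ} (L : V → Finset (Fin q)) (τ : Finset (V × Fin q)) (P : Finset (V × Fin q) → Prop)
    [DecidablePred P] (p : (V → Fin q) → Prop) [DecidablePred p]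
    (hP : ∀ σ, P (coloringFacet σ) ↔ τ ⊆ coloringFacet σ ∧ p σ) :
    ∑ s ∈ coloringFacets G L with P s, uniformWeight (coloringFacets G L) s
      = ((listColorings G (pinnedLists L τ)).filter p).card
        * (1 / ((coloringFacets G L).card : ℝ)) := by
  have h1 : ∑ s ∈ coloringFacets G L with P s, uniformWeight (coloringFacets G L) s
      = ∑ s ∈ coloringFacets G L with P s, 1 / ((coloringFacets G L).card : ℝ) :=
    Finset.sum_congr rfl fun s hs => if_pos (Finset.mem_filter.1 hs).1
  have h2 : (coloringFacets G L).filter P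
      = ((listColorings G (pinnedLists L τ)).filter p).image coloringFacet := by
    ext s
    simp only [coloringFacets_eq_image, Finset.mem_filter, Finset.mem_image,
      mem_listColorings_pinnedLists]
    constructor
    · rintro ⟨⟨σ, hσ, rfl⟩, hs⟩
      exact ⟨σ, ⟨⟨hσ, ((hP σ).1 hs).1⟩, ((hP σ).1 hs).2⟩, rfl⟩
    · rintro ⟨σ, ⟨⟨hσ, hτ⟩, hp⟩, rfl⟩
      exact ⟨⟨σ, hσ, rfl⟩, (hP σ).2 ⟨hτ, hp⟩⟩
  rw [h1, Finset.sum_const, nsmul_eq_mul, h2, Finset.card_image_of_injective _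
    coloringFacet_injective]

theorem containProb_coloringFacets {V : Type*} [Fintype V] [DecidableEq V] (G : SimpleGraph V)
    {q : ℕ} (L : V → Finset (Fin q)) (τ : Finset (V × Fin q)) (x y : V × Fin q)
    (hne : (coloringFacets G L).Nonempty) :
    containProb (coloringFacets G L) (uniformWeight (coloringFacets G L)) {y} (insert x τ)
      = (((listColorings G (pinnedLists L τ)).filter fun σ => σ x.1 = x.2 ∧ σ y.1 = y.2).card : ℝ)
        / ((listColorings G (pinnedLists L τ)).filter fun σ => σ x.1 = x.2).card := by
  have hc : (1 / ((coloringFacets G L).card : ℝ)) ≠ 0 := by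
    have := hne.card_pos
    positivity
  rw [containProb, sum_uniformWeight_filter G L τ _ (fun σ => σ x.1 = x.2 ∧ σ y.1 = y.2)
    (fun σ => by
      rw [Finset.insert_subset_iff, Finset.singleton_subset_iff, mem_coloringFacet,
        mem_coloringFacet]
      tauto),
    sum_uniformWeight_filter G L τ _ (fun σ => σ x.1 = x.2)
    (fun σ => by rw [Finset.insert_subset_iff, mem_coloringFacet]; tauto)]
  exact mul_div_mul_right _ _ hc

theorem exists_mem_of_mem_linkVertices {V : Type*} [Fintype V] [DecidableEq V]
    {G : SimpleGraph V} {q : ℕ} {L : V → Finset (Fin q)} {τ : Finset (V × Fin q)} {x : V × Fin q}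
    (hx : x ∈ linkVertices (coloringFacets G L) τ) :
    ∃ σ ∈ listColorings G (pinnedLists L τ), σ x.1 = x.2 := by
  obtain ⟨-, s, hs, hsub⟩ := (mem_linkVertices _ _ _).1 hx
  rw [coloringFacets_eq_image, Finset.mem_image] at hs
  obtain ⟨σ, hσ, rfl⟩ := hs
  rw [Finset.insert_subset_iff] at hsub
  exact ⟨σ, mem_listColorings_pinnedLists.2 ⟨hσ, hsub.2⟩, mem_coloringFacet.1 hsub.1⟩

/-- Second moments of a sum of functions of the single colors, through the joint distribution of
two colors. -/
theorem sum_sum_card_mul_eq {V : Type*} [Fintype V] [DecidableEq V] {q : ℕ}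
    (Ω : Finset (V → Fin q)) (f : V × Fin q → ℝ) :
    ∑ x, ∑ y, ((Ω.filter fun σ => σ x.1 = x.2 ∧ σ y.1 = y.2).card : ℝ) * f x * f y
      = ∑ σ ∈ Ω, (∑ v, f (v, σ v)) ^ 2 := by
  have h1 : ∀ σ : V → Fin q, ∑ v, f (v, σ v) = ∑ x : V × Fin q, if σ x.1 = x.2 then f x else 0 := by
    intro σ
    rw [Fintype.sum_prod_type]
    simp
  simp only [h1, sq, Finset.sum_mul_sum]
  rw [Finset.sum_comm (s := Ω)]
  refine Finset.sum_congr rfl fun x _ => ?_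
  rw [Finset.sum_comm (s := Ω)]
  refine Finset.sum_congr rfl fun y _ => ?_
  rw [Finset.card_filter]
  push_cast
  rw [Finset.sum_mul, Finset.sum_mul]
  refine Finset.sum_congr rfl fun σ _ => ?_
  by_cases hx : σ x.1 = x.2 <;> by_cases hy : σ y.1 = y.2 <;> simp [hx, hy]

theorem sum_card_mul_eq {V : Type*} [Fintype V] [DecidableEq V] {q : ℕ}
    (Ω : Finset (V → Fin q)) (f : V × Fin q → ℝ) :
    ∑ x, ((Ω.filter fun σ => σ x.1 = x.2).card : ℝ) * f x = ∑ σ ∈ Ω, ∑ v, f (v, σ v) := by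
  have h1 : ∀ σ : V → Fin q, ∑ v, f (v, σ v) = ∑ x : V × Fin q, if σ x.1 = x.2 then f x else 0 := by
    intro σ
    rw [Fintype.sum_prod_type]
    simp
  simp only [h1]
  rw [Finset.sum_comm (s := Ω)]
  refine Finset.sum_congr rfl fun x _ => ?_
  rw [← Finset.sum_filter, Finset.sum_const, nsmul_eq_mul]

/-- A variance bound for the colorings that extend `τ` bounds the second eigenvalue of the local
walk for `τ`. -/
theorem secondEigenvalue_coloringLocalWalk_le {V : Type*} [Fintype V] [DecidableEq V]
    (G : SimpleGraph V) {q : ℕ} (L : V → Finset (Fin q)) (τ : Finset (V × Fin q)) {k m : ℝ}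
    (hk : 0 < k - 1) (hm : 0 ≤ m) (hcodim : (codim ((Fintype.card V : ℤ) - 1) τ : ℝ) = k)
    (hvar : ∀ f : V → Fin q → ℝ,
      ∑ σ ∈ listColorings G (pinnedLists L τ), ∑ v, f v (σ v) = 0 →
      ∑ σ ∈ listColorings G (pinnedLists L τ), (∑ v, f v (σ v)) ^ 2
        ≤ (1 + m) * ∑ σ ∈ listColorings G (pinnedLists L τ), ∑ v, f v (σ v) ^ 2) :
    secondEigenvalue (coloringLocalWalk G L τ) ≤ m / (k - 1) := by
  classical
  set Ω := listColorings G (pinnedLists L τ) with hΩ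
  let n1 : V × Fin q → ℝ := fun x => ((Ω.filter fun σ => σ x.1 = x.2).card : ℝ)
  let n2 : V × Fin q → V × Fin q → ℝ := fun x y =>
    ((Ω.filter fun σ => σ x.1 = x.2 ∧ σ y.1 = y.2).card : ℝ)
  set lk := linkVertices (coloringFacets G L) τ with hlk
  have hn1 : ∀ x ∈ lk, 0 < n1 x := by
    intro x hx
    obtain ⟨σ, hσ, h⟩ := exists_mem_of_mem_linkVertices hx
    exact Nat.cast_pos.2 (Finset.card_pos.2 ⟨σ, Finset.mem_filter.2 ⟨hσ, h⟩⟩)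
  have hsub : ∀ x ∈ lk, x ∈ linkVertices (coloringFacets G L) ∅ := by
    intro x hx
    obtain ⟨-, s, hs, h⟩ := (mem_linkVertices _ _ _).1 hx
    exact (mem_linkVertices _ _ _).2 ⟨Finset.notMem_empty x, s, hs,
      (Finset.insert_subset_insert x (Finset.empty_subset τ)).trans h⟩
  let p : linkVertices (coloringFacets G L) ∅ → ℝ := fun x => if x.1 ∈ lk then n1 x else 1
  have hpA : ∀ x y, p x * coloringLocalWalk G L τ x y
      = if x ≠ y ∧ (x : V × Fin q) ∈ lk ∧ (y : V × Fin q) ∈ lk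
        then 1 / (k - 1) * n2 x y else 0 := by
    intro x y
    simp only [coloringLocalWalk, localWalk, Matrix.of_apply, hcodim, p, ← hlk]
    split_ifs with h1 h2 h2
    · obtain ⟨-, s, hs, -⟩ := (mem_linkVertices _ _ _).1 h1
      rw [containProb_coloringFacets G L τ _ _ ⟨s, hs⟩]
      have := (hn1 _ h1).ne'
      change n1 x * (1 / (k - 1) * (n2 x y / n1 x)) = _
      field_simp
    · rw [mul_zero]
    · exact absurd h2.2.1 h1
    · rw [mul_zero]
  refine secondEigenvalue_le_of_reversible _ p (fun x => ?_) (fun x y => ?_)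
    (fun x => if (x : V × Fin q) ∈ lk then n1 x else 0) (by positivity)
    (fun f hf => ?_)
  · simp only [p]
    split_ifs with h
    · exact hn1 _ h
    · exact one_pos
  · rw [hpA, hpA]
    have e : n2 x y = n2 y x := by simp only [n2, and_comm]
    rw [e]
    refine if_congr ?_ rfl rfl
    rw [ne_comm, and_comm (a := (x : V × Fin q) ∈ _)]
  · -- `f`, extended by zero outside the link
    let g : V × Fin q → ℝ := fun x =>
      if h : x ∈ lk then f ⟨x, hsub x h⟩ else 0
    have hg : ∀ x : linkVertices (coloringFacets G L) ∅, x.1 ∈ lk → g x = f x :=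
      fun x hx => dif_pos hx
    have hg0 : ∀ x, x ∉ lk → g x = 0 := fun x hx => dif_neg hx
    have hext : ∀ Φ : V × Fin q → ℝ, (∀ x, x ∉ lk → Φ x = 0) →
        ∑ x : linkVertices (coloringFacets G L) ∅, Φ x = ∑ x, Φ x := by
      intro Φ hΦ
      rw [Finset.sum_coe_sort (linkVertices (coloringFacets G L) ∅) Φ]
      exact Finset.sum_subset (Finset.subset_univ _) fun x _ hx => hΦ x fun h => hx (hsub x h)
    have hlin : ∑ σ ∈ Ω, ∑ v, g (v, σ v) = 0 := by
      rw [← sum_card_mul_eq, ← hext _ fun x hx => by rw [hg0 x hx, mul_zero], ← hf]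
      refine Finset.sum_congr rfl fun x _ => ?_
      split_ifs with h
      · rw [hg x h]
      · rw [hg0 x h]; ring
    have hsq : ∑ σ ∈ Ω, ∑ v, g (v, σ v) ^ 2 ≤ ∑ x, p x * f x ^ 2 := by
      rw [← sum_card_mul_eq Ω fun x => g x ^ 2, ← hext _ fun x hx => by rw [hg0 x hx]; ring]
      refine Finset.sum_le_sum fun x _ => ?_
      simp only [p]
      split_ifs with h
      · rw [hg x h]
      · rw [hg0 x h]
        simp only [ne_eq, OfNat.ofNat_ne_zero, not_false_eq_true, zero_pow, mul_zero, one_mul]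
        positivity
    have hquad : ∑ x, ∑ y, p x * coloringLocalWalk G L τ x y * f x * f y
        = 1 / (k - 1) * (∑ σ ∈ Ω, (∑ v, g (v, σ v)) ^ 2 - ∑ σ ∈ Ω, ∑ v, g (v, σ v) ^ 2) := by
      have h1 : ∀ x y : linkVertices (coloringFacets G L) ∅,
          p x * coloringLocalWalk G L τ x y * f x * f y
          = 1 / (k - 1) * (n2 x y * g x * g y
            - if (x : V × Fin q) = y then n1 x * g x ^ 2 else 0) := by
        intro x y
        rw [hpA]
        by_cases hx : (x : V × Fin q) ∈ lk
        · by_cases hy : (y : V × Fin q) ∈ lk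
          · rw [hg x hx, hg y hy]
            by_cases hxy : x = y
            · subst hxy
              have : n2 x x = n1 x := by simp only [n1, n2, and_self]
              simp only [ne_eq, not_true_eq_false, false_and, if_false, if_true, this]
              ring
            · rw [if_pos ⟨hxy, hx, hy⟩, if_neg fun h => hxy (Subtype.ext h)]
              ring
          · rw [if_neg fun h => hy h.2.2, hg0 y hy,
              if_neg fun h : (x : V × Fin q) = y => hy (h ▸ hx)]
            ring
        · rw [if_neg fun h => hx h.2.1, hg0 x hx]
          simp
      have h2 : ∀ x : linkVertices (coloringFacets G L) ∅,
          ∑ y, p x * coloringLocalWalk G L τ x y * f x * f y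
          = 1 / (k - 1) * (∑ y, n2 x y * g x * g y - n1 x * g x ^ 2) := by
        intro x
        simp only [h1, ← Finset.mul_sum, Finset.sum_sub_distrib]
        rw [hext (fun y => n2 x y * g x * g y) fun y hy => by rw [hg0 y hy, mul_zero]]
        congr 2
        rw [Finset.sum_eq_single x]
        · simp
        · exact fun y _ hy => if_neg fun h => hy (Subtype.ext h).symm
        · simp
      simp only [h2, ← Finset.mul_sum]
      rw [hext (fun x => ∑ y, n2 x y * g x * g y - n1 x * g x ^ 2) fun x hx => by
        simp [hg0 x hx], Finset.sum_sub_distrib, sum_sum_card_mul_eq,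
        sum_card_mul_eq Ω fun x => g x ^ 2]
    have h3 := hvar (fun v c => g (v, c)) hlin
    rw [hquad, one_div_mul_eq_div, div_mul_eq_mul_div, div_le_div_iff_of_pos_right hk]
    have h4 := mul_le_mul_of_nonneg_left hsq hm
    linarith

theorem mainTheorem7 {V : Type*} [Fintype V] [DecidableEq V] (G : SimpleGraph V)
    [DecidableRel G.Adj] (hG : G.IsTree) {q : ℕ} (L : V → Finset (Fin q))
    (ε : ℝ) (hε : 0 < ε)
    (hL : IsExtraColor G L (ε * (G.maxDegree : ℝ)))
    (hΔ : Real.log (G.maxDegree : ℝ) ^ 2 / (G.maxDegree : ℝ) ≤ ε ^ 2 / 100)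
    (k : ℕ) (hk : 2 ≤ k) (hkn : k ≤ Fintype.card V)
    (τ : Finset (V × Fin q)) (hτ : IsFace (coloringFacets G L) τ)
    (hcodim : codim ((Fintype.card V : ℤ) - 1) τ = (k : ℤ)) :
    secondEigenvalue (coloringLocalWalk G L τ) ≤ (1 / 20 + 1 / ε) / ((k : ℝ) - 1) := by
  have hk' : (2 : ℝ) ≤ k := by exact_mod_cast hk
  have hΔ1 : 1 ≤ G.maxDegree := by
    have : Nontrivial V := Fintype.one_lt_card_iff_nontrivial.1 (by omega)
    obtain ⟨v⟩ := hG.connected.nonempty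
    exact (hG.connected.preconnected.degree_pos_of_nontrivial v).trans_le (G.degree_le_maxDegree v)
  have hΔ0 : (0 : ℝ) < G.maxDegree := by exact_mod_cast hΔ1
  obtain ⟨C, hC, hroot, hother⟩ := exists_recursion_parameter hΔ1 hε hΔ
  have hdeg : ∀ v, (@Finset.filter V (G.Adj v) (fun _ => Classical.propDecidable _)
      Finset.univ).card = G.degree v := by
    intro v
    rw [← SimpleGraph.card_neighborFinset_eq_degree, SimpleGraph.neighborFinset_eq_filter]
    congr
  refine secondEigenvalue_coloringLocalWalk_le G L τ (by linarith) (by positivity)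
    (by rw [hcodim, Int.cast_natCast]) fun f hf => ?_
  refine sum_sq_le_of_sum_eq_zero G hG _ (mul_pos hε hΔ0) hC (by positivity) (fun v => ?_) hroot
    hother (fun v => ?_) f hf
  · rw [hdeg]
    exact G.degree_le_maxDegree v
  · rw [hdeg]
    by_cases hv : ∃ c', (v, c') ∈ τ
    · obtain ⟨c', hc'⟩ := hv
      left
      refine Finset.card_le_one.2 fun a ha b hb => ?_
      rw [(Finset.mem_filter.1 ha).2 c' hc', (Finset.mem_filter.1 hb).2 c' hc']
    · right
      push Not at hv
      have : pinnedLists L τ v = L v :=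
        Finset.filter_true_of_mem fun c _ c' hc' => absurd hc' (hv c')
      rw [this]
      exact hL v
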